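/- Let $p\ge 0$, let $(Z_t)_{t\in\mathbb Z}$ be i.i.d. with $\mathbb E Z_t=0$, $\mathbb E Z_t^2=1$, and let $\{X_{t,N}:t=1,\dots,N\}$ be a time-varying ARCH($p$) process, $$X_{t,N}=\sigma_{t,N}Z_t,\qquad \sigma_{t,N}^2=a_0\!\left(\tfrac tN\right)+\sum_{j=1}^p a_j\!\left(\tfrac tN\right)X_{t-j,N}^2 ,$$ with parameter functions $a_0,\dots,a_p:(0,1]\to\mathbb R$, $\mathbf a_u=(a_0(u),\dots,a_p(u))$, such that: (i) there are constants $0<\rho,Q,M<\infty$, $0<\nu<1$ and a positive sequence $(\ell(j))_{j\ge1}$ with $\sum_{j\ge1} j/\ell(j)<\infty$, $Q\sum_{j\ge1}1/\ell(j)\le 1-\nu$, $\inf_u a_0(u)>\rho$, and, for $1\le j\le p$, $\sup_u a_j(u)\le Q/\ell(j)$ and $|a_j(u)-a_j(v)|\le M|u-v|/\ell(j)$ for all $u,v\in(0,1]$; (ii) $\mathbb E|Z_t|^{4(1+\delta)}<\infty$ for some $\delta>0$; (iii) for some $0<\rho_1\le\rho_2<\infty$ and all $u\in(0,1]$, $\mathbf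 a_u$ lies in the interior of $\{(\alpha_0,\dots,\alpha_p):\sum_{j=1}^p\alpha_j\le1,\ \rho_1\le\alpha_0\le\rho_2,\ \rho_1\le\alpha_i\ (1\le i\le p)\}$. Let $W:[-1/2,1/2]\to\mathbb R$, extended by $0$ to $\mathbb R$, be of bounded variation with $\int W(x)\,dx=1$ and $\int xW(x)\,dx=0$. Fix $u_0\in(0,1)$ and let $(\tilde X_t(u_0))_{t\in\mathbb Z}$ be the strictly stationary ARCH($p$) process satisfying $$\tilde X_t(u_0)=\sigma_t(u_0)Z_t,\qquad \sigma_t(u_0)^2=a_0(u_0)+\sum_{j=1}^p a_j(u_0)\tilde X_{t-j}(u_0)^2\qquad(t\in\mathbb Z).$$ For $\boldsymbol\alpha=(\alpha_0,\dots,\alpha_p)$ put $\tilde w_t(\boldsymbol\alpha)=\alpha_0+\sum_{j=1}^p\alpha_j\tilde X_{t-j}(u_0)^2$, let $t_0=t_0(N)\in\mathbb N$ and $b=b(N)$, and define $$\tilde{\mathcal L}_N(u_0,\boldsymbol\alpha)=\sum_{k=p+1}^N\frac1{bN}W\!\left(\frac{t_0-k}{bN}\right)\frac12\left(\log\tilde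 w_k(\boldsymbol\alpha)+\frac{\tilde X_k(u_0)^2}{\tilde w_k(\boldsymbol\alpha)}\right).$$ If $|u_0-t_0/N|<1/N$ for all $N\geq 1$, and $b\to0$, $bN\to\infty$ as $N\to\infty$, then, with $\nabla$ the gradient in $\boldsymbol\alpha$, $$\sqrt{bN}\,\nabla\tilde{\mathcal L}_N(u_0,\mathbf a_{u_0})\ \xrightarrow{\ \mathcal D\ }\ \mathcal N\!\left(0,\ w_2\,\frac{\operatorname{var}(Z_0^2)}2\,\Sigma(u_0)\right)\qquad(N\to\infty),$$ where $$w_2=\int_{-1/2}^{1/2}W(x)^2\,dx,\qquad \Sigma(u_0)=\frac12\,\mathbb E\left\{\frac{\nabla\tilde w_0(\mathbf a_{u_0})\nabla\tilde w_0(\mathbf a_{u_0})^T}{\tilde w_0(\mathbf a_{u_0})^2}\right\}.$$ -/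

import Mathlib

open MeasureTheory ProbabilityTheory Filter Topology

noncomputable section

namespace TvARCH

/-- Vectors `α = (α₀, α₁, …, α_p)`, with the Euclidean structure. -/
abbrev Param (p : ℕ) : Type := EuclideanSpace ℝ (Fin (p + 1))

/-- The vector `a_u = (a₀(u), …, a_p(u))` of the parameter functions at rescaled time `u`. -/
def coeff {p : ℕ} (a : Fin (p + 1) → ℝ → ℝ) (u : ℝ) : Param p :=
  WithLp.toLp 2 (fun i => a i u)

/-- The ARCH(p) form `α₀ + ∑_{j=1}^p α_j x_{t-j}²` of a trajectory `x : ℤ → ℝ` at time `t`. -/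
def archForm {p : ℕ} (x : ℤ → ℝ) (t : ℤ) (α : Param p) : ℝ :=
  α 0 + ∑ j : Fin p, α j.succ * x (t - ((j : ℤ) + 1)) ^ 2

variable {Ω : Type*} [MeasurableSpace Ω]

/-- `(Z_t)` is i.i.d. with mean zero and variance one. -/
structure IsInnovation (Z : ℤ → Ω → ℝ) (μ : Measure Ω) : Prop where
  aemeasurable : ∀ t, AEMeasurable (Z t) μ
  indep : iIndepFun Z μ
  identDistrib : ∀ t, IdentDistrib (Z t) (Z 0) μ μ
  memLp_two : ∀ t, MemLp (Z t) 2 μ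
  mean : ∀ t, ∫ ω, Z t ω ∂μ = 0
  second_moment : ∀ t, ∫ ω, Z t ω ^ 2 ∂μ = 1

/-- The triangular array `X_{t,N}` (written `X N t`) has the time-varying ARCH(p) representation
`X_{t,N} = σ_{t,N} Z_t`, `σ_{t,N}² = a₀(t/N) + ∑_{j=1}^p a_j(t/N) X_{t-j,N}²`, `t = 1, …, N`. -/
structure IsTvARCH {p : ℕ} (a : Fin (p + 1) → ℝ → ℝ) (Z : ℤ → Ω → ℝ) (X : ℕ → ℤ → Ω → ℝ)
    (μ : Measure Ω) : Prop where
  aemeasurable : ∀ N t, AEMeasurable (X N t) μ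
  repr : ∀ N : ℕ, 1 ≤ N → ∀ t : ℤ, 1 ≤ t → t ≤ (N : ℤ) → ∀ᵐ ω ∂μ,
    X N t ω = √(archForm (fun s => X N s ω) t (coeff a ((t : ℝ) / (N : ℝ)))) * Z t ω

/-- The bounds and the regularity of the parameter functions on the rescaled time interval
`(0, 1]`. The coefficients of order `j > p` are zero and satisfy the same conditions trivially.
If `a₀` were unbounded below, the infimum would be `0` and the first condition would fail. -/
def RegularCoeff {p : ℕ} (a : Fin (p + 1) → ℝ → ℝ) : Prop :=
  ∃ (ρ Q M ν : ℝ) (ℓ : ℕ → ℝ), 0 < ρ ∧ 0 < Q ∧ 0 < M ∧ 0 < ν ∧ ν < 1 ∧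
    (∀ j, 1 ≤ j → 0 < ℓ j) ∧
    ρ < ⨅ u : Set.Ioc (0 : ℝ) 1, a 0 u ∧
    (∀ j : Fin p, ∀ u ∈ Set.Ioc (0 : ℝ) 1, a j.succ u ≤ Q / ℓ (j + 1)) ∧
    Q * ∑' j : ℕ, 1 / ℓ (j + 1) ≤ 1 - ν ∧
    (∀ j : Fin p, ∀ u ∈ Set.Ioc (0 : ℝ) 1, ∀ v ∈ Set.Ioc (0 : ℝ) 1,
      |a j.succ u - a j.succ v| ≤ M * (|u - v| / ℓ (j + 1))) ∧
    Summable (fun j : ℕ => ((j : ℝ) + 1) / ℓ (j + 1))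

/-- The compact parameter space
`{α : ∑_{j=1}^p α_j ≤ 1, ρ₁ ≤ α₀ ≤ ρ₂, ρ₁ ≤ α_i for i = 1, …, p}`. -/
def paramSpace (p : ℕ) (ρ₁ ρ₂ : ℝ) : Set (Param p) :=
  {α | ∑ j : Fin p, α j.succ ≤ 1 ∧ ρ₁ ≤ α 0 ∧ α 0 ≤ ρ₂ ∧ ∀ j : Fin p, ρ₁ ≤ α j.succ}

/-- `Y` is a (strictly) stationary ARCH(p) process with coefficients `α` driven by `Z`:
`Y_t = σ_t Z_t`, `σ_t² = α₀ + ∑_{j=1}^p α_j Y_{t-j}²` for all `t ∈ ℤ`. -/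
structure IsStationaryARCH {p : ℕ} (α : Param p) (Z : ℤ → Ω → ℝ) (Y : ℤ → Ω → ℝ)
    (μ : Measure Ω) : Prop where
  aemeasurable : ∀ t, AEMeasurable (Y t) μ
  repr : ∀ t : ℤ, ∀ᵐ ω ∂μ, Y t ω = √(archForm (fun s => Y s ω) t α) * Z t ω
  stationary : ∀ h : ℤ,
    IdentDistrib (fun ω (t : ℤ) => Y (t + h) ω) (fun ω (t : ℤ) => Y t ω) μ μ

/-- A kernel `W : [-1/2, 1/2] → ℝ` of bounded variation with `∫ W = 1` and `∫ x W(x) dx = 0`,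
extended by zero to the real line. -/
structure IsKernel (W : ℝ → ℝ) : Prop where
  support : ∀ x, x ∉ Set.Icc (-1 / 2 : ℝ) (1 / 2) → W x = 0
  boundedVariation : BoundedVariationOn W (Set.Icc (-1 / 2 : ℝ) (1 / 2))
  integral_one : ∫ x in (-1 / 2 : ℝ)..(1 / 2), W x = 1
  integral_id_mul : ∫ x in (-1 / 2 : ℝ)..(1 / 2), x * W x = 0

/-- The quasi-likelihood contribution
`½ (log w_t(α) + x_t² / w_t(α))` with `w_t(α) = α₀ + ∑_{j=1}^p α_j x_{t-j}²`. -/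
def lik {p : ℕ} (x : ℤ → ℝ) (t : ℤ) (α : Param p) : ℝ :=
  1 / 2 * (Real.log (archForm x t α) + x t ^ 2 / archForm x t α)

/-- The kernel-weighted quasi-likelihood
`∑_{k=p+1}^N (bN)⁻¹ W((t₀ - k)/(bN)) ℓ_k(α)`. -/
def weightedLik {p : ℕ} (W : ℝ → ℝ) (b : ℝ) (N t₀ : ℕ) (x : ℤ → ℝ) (α : Param p) : ℝ :=
  ∑ k ∈ Finset.Icc (p + 1) N,
    1 / (b * (N : ℝ)) * W (((t₀ : ℝ) - (k : ℝ)) / (b * (N : ℝ))) * lik x (k : ℤ) α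

/-- The matrix `Σ = ½ E(∇w₀ ∇w₀ᵀ / w₀²)`, the gradient being taken in the parameter and
evaluated at `α`. -/
def sigmaMatrix {p : ℕ} (Y : ℤ → Ω → ℝ) (α : Param p) (μ : Measure Ω) :
    Matrix (Fin (p + 1)) (Fin (p + 1)) ℝ :=
  Matrix.of fun i j => 1 / 2 * ∫ ω,
    (gradient (archForm (fun s => Y s ω) 0) α) i * (gradient (archForm (fun s => Y s ω) 0) α) j
      / archForm (fun s => Y s ω) 0 α ^ 2 ∂μ

end TvARCH

end

/-! At the true parameter `α = a_{u₀}` the score is a martingale difference. Writing `w_k` for the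
ARCH form, `Y_k² = w_k Z_k²` turns the gradient of the `k`-th likelihood term into `½ (1 - Z_k²)
∇w_k / w_k`. The factor `(1 - Z_k²)/2` is i.i.d., centered and square integrable. The other factor
is a function of the past, and it is bounded because all coefficients of `α` are positive. Tested
against a vector `θ`, it becomes a quotient of two affine forms in the lagged squares
(`affineRatio`).

By Lévy's continuity theorem it suffices to treat `E exp(i S)` for `S = ∑ c_k η_k ξ_k`, with kernel
weights `c_k`, predictable bounded `η_k` and i.i.d. centered `ξ_k`. Dividing each factor `exp(i c_k
η_k ξ_k)` by its conditional characteristic function gives a product of mean one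
(`integral_prod_cexp_div_charFun`). The product of the denominators is close to `exp(-E ξ² ∑ c_k²
η_k² / 2)`, so everything reduces to the `L¹` convergence of `∑ c_k² η_k²`
(`tendsto_integral_cexp_sum`).

That convergence has two ingredients. The sums `∑ c_k²` are Riemann sums of `W²`, which is bounded
and almost everywhere continuous (`tendsto_riemannSum`). A weak law replaces `η_k²` by its mean, and
needs only that covariances vanish at large lags (`exists_abs_covariance_le`). They do because the
recursion for the squares contracts, `∑ a_j < 1`: restarted from zero at time `s`, it forgets `s`
geometrically in mean and uses only innovations after `s`. The same argument shows that a stationary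
solution is causal. All comparisons use distances truncated at `1`, so no moment of `Y` is required.
-/

namespace TvARCH

/-! ### The recursion of the squares, restarted at a finite time -/

/-- The trajectory of the recursion `v_t = x_t (c + ∑_j a_j v_{t-j})` for `t > s`, with the
constant initial value `d` at all times `t ≤ s`. -/
noncomputable def archRec {p : ℕ} (c d : ℝ) (a : Fin p → ℝ) (s : ℤ) (x : ℤ → ℝ) (t : ℤ) : ℝ :=
  if t ≤ s then d
  else x t * (c + ∑ j : Fin p, a j * archRec c d a s x (t - ((j : ℤ) + 1)))
termination_by (t - s).toNat
decreasing_by omega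

section Deterministic

variable {p : ℕ} {c d : ℝ} {a : Fin p → ℝ} {s t : ℤ} {x : ℤ → ℝ}

theorem archRec_of_le (h : t ≤ s) : archRec c d a s x t = d := by
  rw [archRec, if_pos h]

theorem archRec_of_lt (h : s < t) : archRec c d a s x t =
    x t * (c + ∑ j : Fin p, a j * archRec c d a s x (t - ((j : ℤ) + 1))) := by
  rw [archRec, if_neg (not_le.2 h)]

theorem int_strong_induction {P : ℤ → Prop} (s : ℤ) (h0 : ∀ t ≤ s, P t)
    (h1 : ∀ t, s < t → (∀ r < t, P r) → P t) (t : ℤ) : P t := by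
  suffices H : ∀ n : ℕ, ∀ t : ℤ, (t - s).toNat ≤ n → P t from H _ t le_rfl
  intro n
  induction n with
  | zero => exact fun t ht => h0 t (by omega)
  | succ n ih =>
    intro t ht
    rcases le_or_gt t s with h | h
    · exact h0 t h
    · exact h1 t h fun r hr => ih r (by omega)

theorem archRec_nonneg (hc : 0 ≤ c) (hd : 0 ≤ d) (ha : ∀ j, 0 ≤ a j) (hx : ∀ t, 0 ≤ x t) (t : ℤ) :
    0 ≤ archRec c d a s x t := by
  induction t using int_strong_induction s with
  | h0 t ht => rwa [archRec_of_le ht]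
  | h1 t ht ih =>
    rw [archRec_of_lt ht]
    exact mul_nonneg (hx t) (add_nonneg hc (Finset.sum_nonneg fun j _ =>
      mul_nonneg (ha j) (ih _ (by omega))))

theorem archRec_le {v : ℤ → ℝ} (ha : ∀ j, 0 ≤ a j) (hx : ∀ t, 0 ≤ x t) (hv : ∀ t, 0 ≤ v t)
    (hrec : ∀ t, v t = x t * (c + ∑ j : Fin p, a j * v (t - ((j : ℤ) + 1)))) (t : ℤ) :
    archRec c 0 a s x t ≤ v t := by
  induction t using int_strong_induction s with
  | h0 t ht => rw [archRec_of_le ht]; exact hv t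
  | h1 t ht ih =>
    rw [archRec_of_lt ht, hrec t]
    gcongr with j
    · exact hx t
    · exact ha j
    · exact ih _ (by omega)

/-- The difference of two solutions solves the homogeneous recursion, which is linear and monotone
in its initial values. Only the `p` values in `(s - p, s]` enter after time `s`. -/
theorem sub_archRec_le {v : ℤ → ℝ} {K : ℝ} (ha : ∀ j, 0 ≤ a j) (hx : ∀ t, 0 ≤ x t)
    (hrec : ∀ t, v t = x t * (c + ∑ j : Fin p, a j * v (t - ((j : ℤ) + 1))))
    (hK : ∀ r, s - p < r → r ≤ s → v r ≤ K) (t : ℤ) (ht : s - p < t) :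
    v t - archRec c 0 a s x t ≤ K * archRec 0 1 a s x t := by
  induction t using int_strong_induction s with
  | h0 t ht' => rw [archRec_of_le ht', archRec_of_le ht']; simpa using hK t ht ht'
  | h1 t ht' ih =>
    rw [archRec_of_lt ht', archRec_of_lt ht', hrec t, ← mul_sub, zero_add, mul_left_comm,
      add_sub_add_left_eq_sub, ← Finset.sum_sub_distrib, Finset.mul_sum (a := K)]
    refine mul_le_mul_of_nonneg_left (Finset.sum_le_sum fun j _ => ?_) (hx t)
    rw [← mul_sub, mul_left_comm]
    exact mul_le_mul_of_nonneg_left (ih _ (by omega) (by omega)) (ha j)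

end Deterministic

/-! ### Independence of past and future, and geometric decay in mean -/

section Independence

variable {Ω : Type*} {mΩ : MeasurableSpace Ω}

/-- The `σ`-algebra generated by the variables `X_i`, `i ∈ S`. -/
abbrev sigmaOf (X : ℤ → Ω → ℝ) (S : Set ℤ) : MeasurableSpace Ω :=
  ⨆ i ∈ S, MeasurableSpace.comap (X i) inferInstance

variable {X : ℤ → Ω → ℝ} {S T : Set ℤ} {μ : Measure Ω}

theorem sigmaOf_mono (h : S ⊆ T) : sigmaOf X S ≤ sigmaOf X T :=
  biSup_mono fun _ hi => h hi

theorem sigmaOf_le (hX : ∀ t, Measurable (X t)) : sigmaOf X S ≤ mΩ :=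
  iSup₂_le fun i _ => (hX i).comap_le

theorem measurable_sigmaOf {t : ℤ} (h : t ∈ S) : Measurable[sigmaOf X S] (X t) :=
  Measurable.of_comap_le (le_iSup₂_of_le t h le_rfl)

theorem indepFun_of_sigmaOf {E F : Type*} [MeasurableSpace E] [MeasurableSpace F]
    (hX : ∀ t, Measurable (X t)) (hind : iIndepFun X μ) (hST : Disjoint S T)
    {f : Ω → E} {g : Ω → F} (hf : Measurable[sigmaOf X S] f) (hg : Measurable[sigmaOf X T] g) :
    IndepFun f g μ := by
  have h := indep_iSup_of_disjoint (fun i => (hX i).comap_le) hind hST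
  rw [IndepFun_iff_Indep]
  exact indep_of_indep_of_le_left (indep_of_indep_of_le_right h hg.comap_le) hf.comap_le

/-- The left end `s` of the window is what matters: a restarted trajectory is independent of
everything up to the restart. -/
theorem measurable_archRec {p : ℕ} {c d : ℝ} {a : Fin p → ℝ} {s : ℤ} (t : ℤ) :
    Measurable[sigmaOf X (Set.Ioc s t)] fun ω => archRec c d a s (fun r => X r ω) t := by
  induction t using int_strong_induction s with
  | h0 t ht => simp only [archRec_of_le ht]; exact measurable_const
  | h1 t ht ih =>
    simp only [archRec_of_lt ht]
    refine Measurable.mul (measurable_sigmaOf ⟨ht, le_rfl⟩) (measurable_const.add ?_)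
    refine Finset.measurable_fun_sum _ fun j _ => measurable_const.mul ?_
    exact (ih _ (by omega)).mono (sigmaOf_mono (Set.Ioc_subset_Ioc_right (by omega))) le_rfl

variable [IsProbabilityMeasure μ]

/-- Since `X_t` has mean one and is independent of the past, the expectations satisfy the same
recursion without noise. Each application gains a factor `κ` and goes back at most `p` steps, so `m`
gains are available once `t > s + (m - 1) p`. -/
theorem integral_archRec_le {p : ℕ} {a : Fin p → ℝ} {κ : ℝ} {s : ℤ} (hX : ∀ t, Measurable (X t))
    (hX1 : ∀ t, Integrable (X t) μ) (hX2 : ∀ t, ∫ ω, X t ω ∂μ = 1)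
    (hind : iIndepFun X μ) (ha : ∀ j, 0 ≤ a j) (hκ : ∑ j, a j ≤ κ) (hκ1 : κ ≤ 1) (t : ℤ) :
    Integrable (fun ω => archRec 0 1 a s (fun r => X r ω) t) μ ∧
      ∀ m : ℕ, s + (m - 1) * p < t → ∫ ω, archRec 0 1 a s (fun r => X r ω) t ∂μ ≤ κ ^ m := by
  have hκ0 : 0 ≤ κ := (Finset.sum_nonneg fun j _ => ha j).trans hκ
  suffices H : Integrable (fun ω => archRec 0 1 a s (fun r => X r ω) t) μ ∧
      ∫ ω, archRec 0 1 a s (fun r => X r ω) t ∂μ ≤ 1 ∧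
      ∀ m : ℕ, s + (m - 1) * p < t → ∫ ω, archRec 0 1 a s (fun r => X r ω) t ∂μ ≤ κ ^ m from
    ⟨H.1, H.2.2⟩
  induction t using int_strong_induction s with
  | h0 t ht =>
    simp only [archRec_of_le ht]
    refine ⟨integrable_const _, by simp, fun m hm => ?_⟩
    rcases m with _ | m
    · simp
    · push_cast at hm
      have : (0 : ℤ) ≤ m * p := by positivity
      ring_nf at hm
      omega
  | h1 t ht ih =>
    have hI : ∀ j : Fin p, Integrable (fun ω => a j *
        archRec 0 1 a s (fun r => X r ω) (t - ((j : ℤ) + 1))) μ :=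
      fun j => (ih _ (by omega)).1.const_mul _
    have hS : Integrable (fun ω => ∑ j : Fin p, a j *
        archRec 0 1 a s (fun r => X r ω) (t - ((j : ℤ) + 1))) μ :=
      integrable_finsetSum _ fun j _ => hI j
    have hmeas : Measurable[sigmaOf X (Set.Iio t)] (fun ω => ∑ j : Fin p, a j *
        archRec 0 1 a s (fun r => X r ω) (t - ((j : ℤ) + 1))) := by
      refine Finset.measurable_fun_sum _ fun j _ => measurable_const.mul ?_
      exact (measurable_archRec _).mono (sigmaOf_mono fun r hr => by
        simp only [Set.mem_Ioc, Set.mem_Iio] at *; omega) le_rfl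
    have hindep : IndepFun (X t) (fun ω => ∑ j : Fin p, a j *
        archRec 0 1 a s (fun r => X r ω) (t - ((j : ℤ) + 1))) μ :=
      indepFun_of_sigmaOf (S := {t}) hX hind (by simp) (measurable_sigmaOf rfl) hmeas
    have hval : ∫ ω, archRec 0 1 a s (fun r => X r ω) t ∂μ =
        ∑ j : Fin p, a j * ∫ ω, archRec 0 1 a s (fun r => X r ω) (t - ((j : ℤ) + 1)) ∂μ := by
      simp only [archRec_of_lt ht, zero_add]
      rw [hindep.integral_fun_mul_eq_mul_integral (hX t).aestronglyMeasurable
        hS.aestronglyMeasurable, hX2 t, one_mul, integral_finsetSum _ fun j _ => hI j]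
      simp only [integral_const_mul]
    have hbd : ∀ C : ℝ, 0 ≤ C → (∀ j : Fin p,
        ∫ ω, archRec 0 1 a s (fun r => X r ω) (t - ((j : ℤ) + 1)) ∂μ ≤ C) →
        ∫ ω, archRec 0 1 a s (fun r => X r ω) t ∂μ ≤ κ * C := by
      intro C hC h
      rw [hval]
      calc _ ≤ ∑ j : Fin p, a j * C :=
            Finset.sum_le_sum fun j _ => mul_le_mul_of_nonneg_left (h j) (ha j)
        _ = (∑ j, a j) * C := by rw [Finset.sum_mul]
        _ ≤ κ * C := by gcongr
    have h1 : ∫ ω, archRec 0 1 a s (fun r => X r ω) t ∂μ ≤ 1 :=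
      (hbd 1 zero_le_one fun j => (ih _ (by omega)).2.1).trans (by linarith)
    refine ⟨?_, h1, fun m hm => ?_⟩
    · simp only [archRec_of_lt ht, zero_add]
      exact hindep.integrable_mul (hX1 t) hS
    · rcases m with _ | m
      · simpa using h1
      · rw [pow_succ']
        refine hbd _ (by positivity) fun j => (ih _ (by omega)).2.2 m ?_
        push_cast at hm
        have := j.2
        ring_nf at hm ⊢
        omega

end Independence

/-! ### Stationary solutions: forgetting, causality, covariances -/

section Approximation

variable {Ω : Type*} {mΩ : MeasurableSpace Ω} {μ : Measure Ω} {p : ℕ}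

/-- The process `V` of squares of a stationary ARCH process with contracting coefficients, driven
by the independent variables `X` of mean one. -/
structure IsSquareARCH (c : ℝ) (a : Fin p → ℝ) (X V : ℤ → Ω → ℝ) (μ : Measure Ω) : Prop where
  measurable : ∀ t, Measurable (X t)
  nonneg : ∀ t ω, 0 ≤ X t ω
  integrable : ∀ t, Integrable (X t) μ
  integral_eq_one : ∀ t, ∫ ω, X t ω ∂μ = 1
  indep : iIndepFun X μ
  aemeasurable : ∀ t, AEMeasurable (V t) μ
  nonneg' : ∀ t ω, 0 ≤ V t ω
  recurrence : ∀ᵐ ω ∂μ, ∀ t, V t ω = X t ω * (c + ∑ j : Fin p, a j * V (t - ((j : ℤ) + 1)) ω)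
  stationary : ∀ h : ℤ,
    IdentDistrib (fun ω (t : ℤ) => V (t + h) ω) (fun ω (t : ℤ) => V t ω) μ μ
  const_nonneg : 0 ≤ c
  coeff_nonneg : ∀ j, 0 ≤ a j
  sum_lt_one : ∑ j, a j < 1

/-- The `p` values of a trajectory that precede time `t`. -/
abbrev lags (p : ℕ) (v : ℤ → ℝ) (t : ℤ) : Fin p → ℝ := fun j => v (t - ((j : ℤ) + 1))

theorem integrable_min_one [IsProbabilityMeasure μ] {f : Ω → ℝ} (hf : AEMeasurable f μ) (h0 : ∀ᵐ ω ∂μ, 0 ≤ f ω) :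
    Integrable (fun ω => min 1 (f ω)) μ := by
  refine Integrable.of_bound (aemeasurable_const.min hf).aestronglyMeasurable 1 ?_
  filter_upwards [h0] with ω h
  rw [Real.norm_of_nonneg (le_min zero_le_one h)]
  exact min_le_left _ _

theorem tendsto_integral_min_one_div [IsProbabilityMeasure μ] {f : Ω → ℝ} (hf : AEMeasurable f μ) (h0 : ∀ ω, 0 ≤ f ω) :
    Tendsto (fun n : ℕ => ∫ ω, min 1 (f ω / n) ∂μ) atTop (𝓝 0) := by
  have : Tendsto (fun n : ℕ => ∫ ω, min 1 (f ω / n) ∂μ) atTop (𝓝 (∫ _, (0 : ℝ) ∂μ)) := by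
    refine tendsto_integral_of_dominated_convergence (fun _ => 1)
      (fun n => (aemeasurable_const.min (hf.div_const _)).aestronglyMeasurable)
      (integrable_const _) (fun n => ae_of_all _ fun ω => ?_) (ae_of_all _ fun ω => ?_)
    · rw [Real.norm_of_nonneg (le_min zero_le_one (div_nonneg (h0 ω) n.cast_nonneg))]
      exact min_le_left _ _
    · have := (tendsto_const_nhds (x := (1 : ℝ))).min
        (tendsto_const_div_atTop_nhds_zero_nat (f ω))
      simpa using this
  simpa using this

variable {c : ℝ} {a : Fin p → ℝ} {X V : ℤ → Ω → ℝ}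

namespace IsSquareARCH

theorem identDistrib (h : IsSquareARCH c a X V μ) (t : ℤ) : IdentDistrib (V t) (V 0) μ μ := by
  have := (h.stationary t).comp (u := fun x : ℤ → ℝ => x 0) (measurable_pi_apply 0)
  simpa [Function.comp_def] using this

theorem archRec_le (h : IsSquareARCH c a X V μ) :
    ∀ᵐ ω ∂μ, ∀ s t, archRec c 0 a s (fun r => X r ω) t ≤ V t ω := by
  filter_upwards [h.recurrence] with ω hω s t
  exact TvARCH.archRec_le h.coeff_nonneg (fun t => h.nonneg t ω) (fun t => h.nonneg' t ω) hω t

theorem measurable_archRec (h : IsSquareARCH c a X V μ) {d c' : ℝ} (s t : ℤ) :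
    Measurable fun ω => archRec c' d a s (fun r => X r ω) t :=
  (TvARCH.measurable_archRec t).mono (sigmaOf_le h.measurable) le_rfl

theorem aemeasurable_sub (h : IsSquareARCH c a X V μ) (s t : ℤ) :
    AEMeasurable (fun ω => V t ω - archRec c 0 a s (fun r => X r ω) t) μ :=
  (h.aemeasurable t).sub (h.measurable_archRec s t).aemeasurable

variable {Ψ : (Fin p → ℝ) → ℝ} {B L : ℝ}

theorem aemeasurable_comp_lags (h : IsSquareARCH c a X V μ) (hΨ : Measurable Ψ) (t : ℤ) :
    AEMeasurable (fun ω => Ψ (lags p (fun r => V r ω) t)) μ :=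
  hΨ.comp_aemeasurable (aemeasurable_pi_lambda _ fun _ => h.aemeasurable _)

theorem identDistrib_comp_lags (h : IsSquareARCH c a X V μ) (hΨ : Measurable Ψ) (t : ℤ) :
    IdentDistrib (fun ω => Ψ (lags p (fun r => V r ω) t))
      (fun ω => Ψ (lags p (fun r => V r ω) 0)) μ μ := by
  have := (h.stationary t).comp (u := fun x : ℤ → ℝ => Ψ (lags p x 0))
    (hΨ.comp (measurable_pi_lambda _ fun j => measurable_pi_apply _))
  have hshift : (fun x : ℤ → ℝ => Ψ (lags p x 0)) ∘ (fun ω (r : ℤ) => V (r + t) ω) =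
      fun ω => Ψ (lags p (fun r => V r ω) t) := by
    funext ω
    simp only [Function.comp_apply]
    congr 1
    funext j
    simp only [lags]
    congr 1
    ring
  rwa [hshift] at this

variable [IsProbabilityMeasure μ]

theorem integrable_min (h : IsSquareARCH c a X V μ) (s t : ℤ) :
    Integrable (fun ω => min 1 (V t ω - archRec c 0 a s (fun r => X r ω) t)) μ := by
  refine integrable_min_one (h.aemeasurable_sub s t) ?_
  filter_upwards [h.archRec_le] with ω hω using sub_nonneg.2 (hω s t)

/-- The process forgets its past: restarting the recursion at a remote time changes its value
little, uniformly in time. -/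
theorem exists_integral_min_le (h : IsSquareARCH c a X V μ) {δ : ℝ} (hδ : 0 < δ) :
    ∃ M : ℕ, ∀ s t : ℤ, s + M ≤ t →
      ∫ ω, min 1 (V t ω - archRec c 0 a s (fun r => X r ω) t) ∂μ ≤ δ := by
  set κ := ∑ j, a j with hκ
  have hκ0 : 0 ≤ κ := Finset.sum_nonneg fun j _ => h.coeff_nonneg j
  -- `C` makes it unlikely that one of the `p` values before the restart exceeds `C`. By
  -- stationarity the same `C` serves every `s`. Then `m` is chosen so that the contraction beats
  -- `C`.
  obtain ⟨C, hC, hC0⟩ : ∃ C : ℕ, p * ∫ ω, min 1 (V 0 ω / C) ∂μ < δ / 2 ∧ 0 < C := by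
    have h1 := (tendsto_integral_min_one_div (h.aemeasurable 0) (h.nonneg' 0)).const_mul (p : ℝ)
    rw [mul_zero] at h1
    exact ((h1.eventually_lt_const (half_pos hδ)).and (eventually_gt_atTop 0)).exists
  obtain ⟨m, hm⟩ : ∃ m : ℕ, C * κ ^ m < δ / 2 := by
    have h1 := (tendsto_pow_atTop_nhds_zero_of_lt_one hκ0 h.sum_lt_one).const_mul (C : ℝ)
    rw [mul_zero] at h1
    exact (h1.eventually_lt_const (half_pos hδ)).exists
  have hC0' : (0 : ℝ) < C := by exact_mod_cast hC0
  refine ⟨m * p + 1, fun s t hst => ?_⟩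
  have hG := integral_archRec_le (s := s) h.measurable h.integrable h.integral_eq_one h.indep
    h.coeff_nonneg hκ.ge h.sum_lt_one.le t
  have hI : ∀ i : Fin p, Integrable (fun ω => min 1 (V (s - i) ω / C)) μ := fun i =>
    integrable_min_one ((h.aemeasurable _).div_const _)
      (ae_of_all _ fun ω => div_nonneg (h.nonneg' _ ω) hC0'.le)
  have hmp : (0 : ℤ) ≤ m * p := by positivity
  -- Either all initial values are at most `C` and the linear comparison applies, or some summand
  -- `min 1 (V / C)` equals `1` and dominates the left side.
  have hle : ∀ᵐ ω ∂μ, min 1 (V t ω - archRec c 0 a s (fun r => X r ω) t) ≤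
      ∑ i : Fin p, min 1 (V (s - i) ω / C) + C * archRec 0 1 a s (fun r => X r ω) t := by
    filter_upwards [h.recurrence] with ω hω
    have hpos : 0 ≤ archRec 0 1 a s (fun r => X r ω) t :=
      archRec_nonneg le_rfl zero_le_one h.coeff_nonneg (fun t => h.nonneg t ω) t
    have hterm : ∀ i ∈ (Finset.univ : Finset (Fin p)), 0 ≤ min 1 (V (s - i) ω / C) := fun i _ =>
      le_min zero_le_one (div_nonneg (h.nonneg' _ ω) hC0'.le)
    by_cases hall : ∀ i : Fin p, V (s - i) ω ≤ C
    · have h1 := sub_archRec_le (s := s) (K := C) h.coeff_nonneg (fun t => h.nonneg t ω) hω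
        (fun r hr hr' => by
          have := hall ⟨(s - r).toNat, by omega⟩
          rwa [show s - ((⟨(s - r).toNat, by omega⟩ : Fin p) : ℕ) = r by
            simp only [Int.toNat_of_nonneg (sub_nonneg.2 hr')]; ring] at this) t (by
            push_cast at hst; omega)
      have := Finset.sum_nonneg hterm
      exact (min_le_right _ _).trans (by linarith)
    · push Not at hall
      obtain ⟨i, hi⟩ := hall
      have h1 : min 1 (V (s - i) ω / C) = 1 := min_eq_left ((one_le_div hC0').2 hi.le)
      have h2 := Finset.single_le_sum hterm (Finset.mem_univ i)
      rw [h1] at h2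
      exact (min_le_left _ _).trans (by nlinarith)
  calc _ ≤ ∫ ω, (∑ i : Fin p, min 1 (V (s - i) ω / C) +
          C * archRec 0 1 a s (fun r => X r ω) t) ∂μ :=
        integral_mono_ae (h.integrable_min s t)
          ((integrable_finsetSum _ fun i _ => hI i).add (hG.1.const_mul _)) hle
    _ = ∑ i : Fin p, ∫ ω, min 1 (V (s - i) ω / C) ∂μ +
          C * ∫ ω, archRec 0 1 a s (fun r => X r ω) t ∂μ := by
        rw [integral_add (integrable_finsetSum _ fun i _ => hI i) (hG.1.const_mul _),
          integral_finsetSum _ fun i _ => hI i, integral_const_mul]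
    _ = p * ∫ ω, min 1 (V 0 ω / C) ∂μ + C * ∫ ω, archRec 0 1 a s (fun r => X r ω) t ∂μ := by
        congr 1
        have hint : ∀ i : Fin p, ∫ ω, min 1 (V (s - i) ω / C) ∂μ = ∫ ω, min 1 (V 0 ω / C) ∂μ :=
          fun i => ((h.identDistrib (s - i)).comp
            (u := fun x : ℝ => min 1 (x / C)) (by fun_prop)).integral_eq
        simp [hint]
    _ ≤ δ / 2 + C * κ ^ m := by
        gcongr
        refine hG.2 m ?_
        push_cast at hst
        have hp : (0 : ℤ) ≤ p := by positivity
        ring_nf at hst ⊢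
        omega
    _ ≤ δ := by linarith

/-- A stationary solution is causal: up to a null set, `V_t` is a function of `X_s`, `s ≤ t`. -/
theorem exists_causal (h : IsSquareARCH c a X V μ) (t : ℤ) :
    ∃ V' : Ω → ℝ, Measurable[sigmaOf X (Set.Iic t)] V' ∧ V t =ᵐ[μ] V' := by
  -- A supremum is exactly measurable for the past. Where the terms are unbounded it takes the
  -- default value `0`, but almost surely they are bounded by `V t`.
  let V' : Ω → ℝ := fun ω => ⨆ n : ℕ, archRec c 0 a (t - n) (fun r => X r ω) t
  have hmeas : Measurable[sigmaOf X (Set.Iic t)] V' :=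
    Measurable.iSup fun n => (TvARCH.measurable_archRec t).mono
      (sigmaOf_mono Set.Ioc_subset_Iic_self) le_rfl
  refine ⟨V', hmeas, ?_⟩
  have hmeas' : Measurable V' := hmeas.mono (sigmaOf_le h.measurable) le_rfl
  have hle : ∀ᵐ ω ∂μ, V' ω ≤ V t ω ∧ ∀ n : ℕ, archRec c 0 a (t - n) (fun r => X r ω) t ≤ V' ω := by
    filter_upwards [h.archRec_le] with ω hω
    exact ⟨ciSup_le fun n => hω _ t, fun n => le_ciSup
      (f := fun n : ℕ => archRec c 0 a (t - n) (fun r => X r ω) t)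
      ⟨V t ω, by rintro _ ⟨n, rfl⟩; exact hω _ t⟩ n⟩
  have hnn : ∀ᵐ ω ∂μ, 0 ≤ min 1 (V t ω - V' ω) := by
    filter_upwards [hle] with ω hω using le_min zero_le_one (sub_nonneg.2 hω.1)
  have hint : Integrable (fun ω => min 1 (V t ω - V' ω)) μ :=
    integrable_min_one ((h.aemeasurable t).sub hmeas'.aemeasurable) (by
      filter_upwards [hle] with ω hω using sub_nonneg.2 hω.1)
  have h0 : ∫ ω, min 1 (V t ω - V' ω) ∂μ = 0 := by
    refine le_antisymm (le_of_forall_pos_le_add fun δ hδ => ?_) (integral_nonneg_of_ae hnn)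
    obtain ⟨M, hM⟩ := h.exists_integral_min_le hδ
    rw [zero_add]
    refine le_trans (integral_mono_ae hint (h.integrable_min _ t) ?_) (hM (t - M) t (by omega))
    filter_upwards [hle] with ω hω
    exact min_le_min_left _ (sub_le_sub_left (hω.2 M) _)
  filter_upwards [(integral_eq_zero_iff_of_nonneg_ae hnn hint).1 h0, hle] with ω h1 h2
  simp only [Pi.zero_apply] at h1
  rcases min_choice 1 (V t ω - V' ω) with h3 | h3 <;> linarith

/-- The central limit theorem needs predictable factors that are bounded at every `ω`. The version
is therefore built from nonnegative arguments everywhere, by taking `max 0`, so bounds on `Ψ` over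
nonnegative vectors carry over. -/
theorem exists_causal_comp (h : IsSquareARCH c a X V μ) (hΨ : Measurable Ψ)
    (t : ℤ) : ∃ G : Ω → ℝ, Measurable[sigmaOf X (Set.Iio t)] G ∧
      (fun ω => Ψ (lags p (fun r => V r ω) t)) =ᵐ[μ] G ∧ ∃ v : Ω → Fin p → ℝ, (∀ ω, G ω = Ψ (v ω)) ∧
      (∀ ω j, 0 ≤ v ω j) := by
  choose V' hV' hVV' using h.exists_causal
  refine ⟨fun ω => Ψ fun j => max 0 (V' (t - ((j : ℤ) + 1)) ω), ?_, ?_, _, fun _ => rfl,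
    fun ω j => le_max_left _ _⟩
  · refine hΨ.comp (@measurable_pi_lambda _ _ _ (sigmaOf X _) _ _ fun j => measurable_const.max ?_)
    exact (hV' _).mono (sigmaOf_mono fun r hr => by
      simp only [Set.mem_Iic, Set.mem_Iio] at *; omega) le_rfl
  · filter_upwards [ae_all_iff.2 hVV'] with ω hω
    congr 1
    funext j
    rw [← hω, max_eq_right (h.nonneg' _ _)]

theorem exists_integral_abs_sub_le (h : IsSquareARCH c a X V μ) (hL0 : 0 ≤ L)
    (hL : ∀ v w, (∀ j, 0 ≤ v j) → (∀ j, 0 ≤ w j) → |Ψ v - Ψ w| ≤ L * ∑ j, min 1 |v j - w j|)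
    {δ : ℝ} (hδ : 0 < δ) :
    ∃ M : ℕ, ∀ s t : ℤ, s + M ≤ t →
      ∫ ω, |Ψ (lags p (fun r => V r ω) t) -
        Ψ (lags p (fun r => archRec c 0 a s (fun r => X r ω) r) t)| ∂μ ≤ δ := by
  obtain ⟨M, hM⟩ := h.exists_integral_min_le (δ := δ / (L * p + 1)) (by positivity)
  -- The lags reach back `p` steps from `t`. The `+ 1` in `δ / (L * p + 1)` covers `L * p = 0`.
  refine ⟨M + p, fun s t hst => ?_⟩
  have hI : ∀ j : Fin p, Integrable (fun ω => min 1 (V (t - ((j : ℤ) + 1)) ω -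
      archRec c 0 a s (fun r => X r ω) (t - ((j : ℤ) + 1)))) μ := fun j => h.integrable_min _ _
  calc _ ≤ ∫ ω, L * ∑ j : Fin p, min 1 (V (t - ((j : ℤ) + 1)) ω -
        archRec c 0 a s (fun r => X r ω) (t - ((j : ℤ) + 1))) ∂μ := by
        refine integral_mono_of_nonneg (ae_of_all _ fun ω => abs_nonneg _)
          ((integrable_finsetSum _ fun j _ => hI j).const_mul L) ?_
        filter_upwards [h.archRec_le] with ω hω
        refine (hL _ _ (fun j => h.nonneg' _ _) (fun j => archRec_nonneg h.const_nonneg le_rfl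
          h.coeff_nonneg (fun t => h.nonneg t ω) _)).trans_eq ?_
        congr 1
        refine Finset.sum_congr rfl fun j _ => ?_
        rw [abs_of_nonneg (sub_nonneg.2 (hω _ _))]
    _ = L * ∑ j : Fin p, ∫ ω, min 1 (V (t - ((j : ℤ) + 1)) ω -
        archRec c 0 a s (fun r => X r ω) (t - ((j : ℤ) + 1))) ∂μ := by
        rw [integral_const_mul, integral_finsetSum _ fun j _ => hI j]
    _ ≤ L * ∑ j : Fin p, δ / (L * p + 1) := by
        gcongr with j
        exact hM _ _ (by push_cast at hst; omega)
    _ = δ * (L * p / (L * p + 1)) := by simp; ring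
    _ ≤ δ := mul_le_of_le_one_right hδ.le ((div_le_one (by positivity)).2 (by linarith))

/-- The covariances of a bounded Lipschitz function of the lagged process vanish at large lags. -/
theorem exists_abs_covariance_le (h : IsSquareARCH c a X V μ) (hΨ : Measurable Ψ)
    (hB : ∀ v, (∀ j, 0 ≤ v j) → |Ψ v| ≤ B) (hL0 : 0 ≤ L)
    (hL : ∀ v w, (∀ j, 0 ≤ v j) → (∀ j, 0 ≤ w j) → |Ψ v - Ψ w| ≤ L * ∑ j, min 1 |v j - w j|)
    {γ : ℝ} (hγ : ∫ ω, Ψ (lags p (fun r => V r ω) 0) ∂μ = γ) {δ : ℝ} (hδ : 0 < δ) :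
    ∃ M : ℕ, ∀ s t : ℤ, s + M ≤ t →
      ∫ ω, (Ψ (lags p (fun r => V r ω) s) - γ) * (Ψ (lags p (fun r => V r ω) t) - γ) ∂μ ≤ δ := by
  have hB0 : 0 ≤ B := (abs_nonneg _).trans (hB 0 fun _ => le_rfl)
  have hint : ∀ t, Integrable (fun ω => Ψ (lags p (fun r => V r ω) t)) μ := fun t =>
    Integrable.of_bound (h.aemeasurable_comp_lags hΨ t).aestronglyMeasurable B
      (ae_of_all _ fun ω => hB _ fun j => h.nonneg' _ _)
  have hmean : ∀ t, ∫ ω, Ψ (lags p (fun r => V r ω) t) ∂μ = γ := fun t =>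
    (h.identDistrib_comp_lags hΨ t).integral_eq.trans hγ
  have hγB : |γ| ≤ B := by
    rw [← hγ]
    have := norm_integral_le_of_norm_le_const (μ := μ) (C := B)
      (f := fun ω => Ψ (lags p (fun r => V r ω) 0))
      (ae_of_all _ fun ω => hB (lags p (fun r => V r ω) 0) fun j => h.nonneg' _ _)
    simpa using this
  obtain ⟨M, hM⟩ := h.exists_integral_abs_sub_le hL0 hL (δ := δ / (2 * B + 1)) (by positivity)
  refine ⟨M, fun s t hst => ?_⟩
  set f : Ω → ℝ := fun ω => Ψ (lags p (fun r => V r ω) s) - γ with hf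
  -- `g` uses only innovations after `s`, while `f` is centered and almost surely a function of
  -- those before `s`; hence `E (f g) = 0`. Replacing `Ψ` at time `t` by `g` costs at most `2 B E |Ψ
  -- - g|`.
  set g : Ω → ℝ := fun ω => Ψ (lags p (fun r => archRec c 0 a s (fun r => X r ω) r) t) with hg
  have hgm : Measurable[sigmaOf X (Set.Ioi s)] g :=
    hΨ.comp (@measurable_pi_lambda _ _ _ (sigmaOf X _) _ _ fun j =>
      (TvARCH.measurable_archRec _).mono
      (sigmaOf_mono Set.Ioc_subset_Ioi_self) le_rfl)
  have hgm' : Measurable g := hgm.mono (sigmaOf_le h.measurable) le_rfl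
  have hgB : ∀ ω, |g ω| ≤ B := fun ω => hB _ fun j => archRec_nonneg h.const_nonneg le_rfl
    h.coeff_nonneg (fun t => h.nonneg t ω) _
  have hfB : ∀ ω, |f ω| ≤ 2 * B := fun ω => by
    have := hB (lags p (fun r => V r ω) s) fun j => h.nonneg' _ _
    calc |f ω| ≤ _ := abs_sub _ _
      _ ≤ 2 * B := by linarith
  have hfm : AEMeasurable f μ := (h.aemeasurable_comp_lags hΨ s).sub_const γ
  have hfI : Integrable f μ := (hint s).sub (integrable_const γ)
  have hf0 : ∫ ω, f ω ∂μ = 0 := by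
    rw [hf, integral_sub (hint s) (integrable_const γ), hmean]; simp
  have hindep : IndepFun f g μ := by
    obtain ⟨G, hG, hG', -⟩ := h.exists_causal_comp hΨ s
    refine (indepFun_of_sigmaOf (f := fun ω => G ω - γ) h.measurable h.indep
      (Set.disjoint_left.2 fun r (hr : r < s) (hr' : s < r) => lt_asymm hr hr')
      (hG.sub_const γ) hgm).congr ?_ EventuallyEq.rfl
    filter_upwards [hG'] with ω hω
    simp [hf, hω]
  have hfg : ∫ ω, f ω * g ω ∂μ = 0 := by
    rw [hindep.integral_fun_mul_eq_mul_integral hfm.aestronglyMeasurable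
      hgm'.aestronglyMeasurable, hf0, zero_mul]
  have hIfg : Integrable (fun ω => f ω * g ω) μ :=
    hfI.mul_bdd (c := B) hgm'.aestronglyMeasurable (ae_of_all _ hgB)
  have hD : Integrable (fun ω => |Ψ (lags p (fun r => V r ω) t) - g ω|) μ :=
    ((hint t).sub (Integrable.of_bound hgm'.aestronglyMeasurable B (ae_of_all _ hgB))).abs
  have hIt : Integrable (fun ω => f ω * (Ψ (lags p (fun r => V r ω) t) - γ)) μ :=
    ((hint t).sub (integrable_const γ)).bdd_mul (c := 2 * B) hfm.aestronglyMeasurable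
      (ae_of_all _ hfB)
  calc ∫ ω, f ω * (Ψ (lags p (fun r => V r ω) t) - γ) ∂μ
      ≤ ∫ ω, (2 * B * |Ψ (lags p (fun r => V r ω) t) - g ω| + (f ω * g ω - γ * f ω)) ∂μ := by
        refine integral_mono hIt ((hD.const_mul _).add (hIfg.sub (hfI.const_mul γ))) fun ω => ?_
        have h1 : f ω * (Ψ (lags p (fun r => V r ω) t) - g ω) ≤
            2 * B * |Ψ (lags p (fun r => V r ω) t) - g ω| := by
          refine (le_abs_self _).trans ?_
          rw [abs_mul]
          exact mul_le_mul_of_nonneg_right (hfB ω) (abs_nonneg _)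
        simp only
        linarith
    _ = 2 * B * ∫ ω, |Ψ (lags p (fun r => V r ω) t) - g ω| ∂μ := by
        have := integral_add (hD.const_mul (2 * B)) (hIfg.sub (hfI.const_mul γ))
        simp only [Pi.sub_apply] at this
        rw [this, integral_sub hIfg (hfI.const_mul γ), integral_const_mul, integral_const_mul, hfg, hf0]
        ring
    _ ≤ 2 * B * (δ / (2 * B + 1)) := by gcongr; exact hM s t hst
    _ = δ * (2 * B / (2 * B + 1)) := by ring
    _ ≤ δ := mul_le_of_le_one_right hδ.le ((div_le_one (by positivity)).2 (by linarith))

end IsSquareARCH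

end Approximation

/-! ### A martingale central limit theorem by characteristic functions -/

section CentralLimit

theorem norm_prod_sub_prod_le {ι : Type*} (s : Finset ι) (f g : ι → ℂ)
    (hf : ∀ i ∈ s, ‖f i‖ ≤ 1) (hg : ∀ i ∈ s, ‖g i‖ ≤ 1) :
    ‖∏ i ∈ s, f i - ∏ i ∈ s, g i‖ ≤ ∑ i ∈ s, ‖f i - g i‖ := by
  classical
  induction s using Finset.induction_on with
  | empty => simp
  | insert i s hi ih =>
    rw [Finset.prod_insert hi, Finset.prod_insert hi, Finset.sum_insert hi]
    have hg' : ‖∏ j ∈ s, g j‖ ≤ 1 := by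
      rw [norm_prod]
      exact Finset.prod_le_one (fun _ _ => norm_nonneg _) fun j hj =>
        hg j (Finset.mem_insert_of_mem hj)
    have := ih (fun j hj => hf j (Finset.mem_insert_of_mem hj))
      fun j hj => hg j (Finset.mem_insert_of_mem hj)
    calc _ = ‖f i * (∏ j ∈ s, f j - ∏ j ∈ s, g j) + (f i - g i) * ∏ j ∈ s, g j‖ := by
          congr 1; ring
      _ ≤ ‖f i‖ * ‖∏ j ∈ s, f j - ∏ j ∈ s, g j‖ + ‖f i - g i‖ * ‖∏ j ∈ s, g j‖ := by
          rw [← norm_mul, ← norm_mul]; exact norm_add_le _ _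
      _ ≤ 1 * ∑ j ∈ s, ‖f j - g j‖ + ‖f i - g i‖ * 1 := by
          gcongr
          exact hf i (Finset.mem_insert_self _ _)
      _ = _ := by ring

theorem abs_exp_neg_sub_exp_neg_le {x y : ℝ} (hx : 0 ≤ x) (hy : 0 ≤ y) :
    |Real.exp (-x) - Real.exp (-y)| ≤ |x - y| := by
  wlog h : x ≤ y generalizing x y
  · rw [abs_sub_comm, abs_sub_comm x]
    exact this hy hx (le_of_not_ge h)
  rw [abs_of_nonneg (sub_nonneg.2 (Real.exp_le_exp.2 (neg_le_neg h))), abs_sub_comm,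
    abs_of_nonneg (sub_nonneg.2 h)]
  have h1 : Real.exp (-y) = Real.exp (-x) * Real.exp (-(y - x)) := by
    rw [← Real.exp_add]; congr 1; ring
  have h2 : Real.exp (-x) ≤ 1 := Real.exp_le_one_iff.2 (by linarith)
  have h3 : 1 - (y - x) ≤ Real.exp (-(y - x)) := by
    have := Real.add_one_le_exp (-(y - x)); linarith
  rw [h1]
  nlinarith [Real.exp_pos (-x)]

variable {Ω : Type*} {mΩ : MeasurableSpace Ω} {μ : Measure Ω} [IsProbabilityMeasure μ]

/-- Fubini on the product law of `(U, η)` and `ξ`: integrating out `ξ` plays the role of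
conditioning. -/
theorem integral_mul_cexp_of_indepFun {U : Ω → ℂ} {η ξ : Ω → ℝ} {K : ℝ} (hU : Measurable U)
    (hη : Measurable η) (hξ : Measurable ξ) (hK : ∀ ω, ‖U ω‖ ≤ K)
    (hind : IndepFun (fun ω => (U ω, η ω)) ξ μ) :
    ∫ ω, U ω * Complex.exp (η ω * ξ ω * Complex.I) ∂μ =
      ∫ ω, U ω * charFun (μ.map ξ) (η ω) ∂μ := by
  have hξP : IsProbabilityMeasure (μ.map ξ) := Measure.isProbabilityMeasure_map hξ.aemeasurable
  have hUη : Measurable fun ω => (U ω, η ω) := hU.prodMk hη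
  have hPP : IsProbabilityMeasure (μ.map fun ω => (U ω, η ω)) :=
    Measure.isProbabilityMeasure_map hUη.aemeasurable
  let f : (ℂ × ℝ) × ℝ → ℂ := fun z => z.1.1 * Complex.exp (z.1.2 * z.2 * Complex.I)
  have hf : Measurable f := by fun_prop
  have hmap := (indepFun_iff_map_prod_eq_prod_map_map hUη.aemeasurable hξ.aemeasurable).1 hind
  have hmeas : Measurable fun ω => ((U ω, η ω), ξ ω) := hUη.prodMk hξ
  have hnorm : ∀ (x y : ℝ), ‖Complex.exp (x * y * Complex.I)‖ = 1 := fun x y => by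
    rw [← Complex.ofReal_mul, Complex.norm_exp_ofReal_mul_I]
  have hint : Integrable f ((μ.map fun ω => (U ω, η ω)).prod (μ.map ξ)) := by
    rw [← hmap, integrable_map_measure hf.aestronglyMeasurable hmeas.aemeasurable]
    refine Integrable.of_bound (hf.comp hmeas).aestronglyMeasurable K (ae_of_all _ fun ω => ?_)
    simp only [f, Function.comp_apply, norm_mul, hnorm, mul_one]
    exact hK ω
  calc _ = ∫ z, f z ∂(μ.map fun ω => ((U ω, η ω), ξ ω)) := by
        rw [integral_map hmeas.aemeasurable hf.aestronglyMeasurable]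
    _ = ∫ z, z.1 * charFun (μ.map ξ) z.2 ∂(μ.map fun ω => (U ω, η ω)) := by
        rw [hmap, integral_prod _ hint]
        refine integral_congr_ae (ae_of_all _ fun z => ?_)
        simp only [f]
        rw [integral_const_mul, charFun_apply_real]
    _ = _ := by
        rw [integral_map hUη.aemeasurable]
        exact (measurable_fst.mul (continuous_charFun.measurable.comp
          measurable_snd)).aestronglyMeasurable

/-- The partial products form a complex martingale started at `1`: given `F n`, the next factor has
mean one. The lower bound on the denominators only provides integrability. -/
theorem integral_prod_cexp_div_charFun {F : ℕ → MeasurableSpace Ω} (hF : ∀ k, F k ≤ mΩ)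
    (hmono : Monotone F) {ξ ζ : ℕ → Ω → ℝ} {ν : Measure ℝ} [IsProbabilityMeasure ν]
    (hξ : ∀ k, Measurable[F (k + 1)] (ξ k))
    (hζ : ∀ k, Measurable[F k] (ζ k)) (hind : ∀ k, Indep (F k) (MeasurableSpace.comap (ξ k)
      inferInstance) μ) (hν : ∀ k, μ.map (ξ k) = ν)
    (hφ : ∀ k ω, 1 / 2 ≤ ‖charFun ν (ζ k ω)‖) (n : ℕ) :
    ∫ ω, ∏ k ∈ Finset.range n,
      (Complex.exp (ζ k ω * ξ k ω * Complex.I) / charFun ν (ζ k ω)) ∂μ = 1 := by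
  have hχ : Measurable (charFun ν) := continuous_charFun.measurable
  have hmeasP : ∀ n, Measurable[F n] fun ω => ∏ k ∈ Finset.range n,
      (Complex.exp (ζ k ω * ξ k ω * Complex.I) / charFun ν (ζ k ω)) := by
    intro n
    refine Finset.measurable_fun_prod _ fun k hk => ?_
    have hk' : k + 1 ≤ n := Finset.mem_range.1 hk
    have h1 : Measurable[F n] (ζ k) := (hζ k).mono (hmono (by omega)) le_rfl
    have h2 : Measurable[F n] (ξ k) := (hξ k).mono (hmono hk') le_rfl
    refine Measurable.div ?_ (hχ.comp h1)
    exact Complex.measurable_exp.comp (((Complex.measurable_ofReal.comp h1).mul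
      (Complex.measurable_ofReal.comp h2)).mul measurable_const)
  have hnormP : ∀ n ω, ‖∏ k ∈ Finset.range n,
      (Complex.exp (ζ k ω * ξ k ω * Complex.I) / charFun ν (ζ k ω))‖ ≤ 2 ^ n := by
    intro n ω
    rw [norm_prod]
    refine (Finset.prod_le_prod (fun _ _ => norm_nonneg _) (g := fun _ => 2)
      fun k _ => ?_).trans_eq (by simp)
    rw [norm_div, ← Complex.ofReal_mul, Complex.norm_exp_ofReal_mul_I]
    have := hφ k ω
    rw [div_le_iff₀ (by linarith)]
    linarith
  induction n with
  | zero => simp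
  | succ n ih =>
    have hζn : Measurable (ζ n) := (hζ n).mono (hF n) le_rfl
    have hUm : Measurable[F n] fun ω => (∏ k ∈ Finset.range n,
        (Complex.exp (ζ k ω * ξ k ω * Complex.I) / charFun ν (ζ k ω))) / charFun ν (ζ n ω) :=
      (hmeasP n).div (hχ.comp (hζ n))
    have key := integral_mul_cexp_of_indepFun (μ := μ) (ξ := ξ n) (K := 2 ^ n * 2)
      (hUm.mono (hF n) le_rfl) hζn ((hξ n).mono (hF _) le_rfl) (fun ω => by
        rw [norm_div, div_eq_mul_inv]
        gcongr
        · exact hnormP n ω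
        · rw [inv_le_comm₀ (by linarith [hφ n ω]) (by norm_num)]
          linarith [hφ n ω]) (by
        rw [IndepFun_iff_Indep]
        exact indep_of_indep_of_le_left (hind n) (hUm.prodMk (hζ n)).comap_le)
    rw [hν n] at key
    calc _ = ∫ ω, (∏ k ∈ Finset.range n,
        (Complex.exp (ζ k ω * ξ k ω * Complex.I) / charFun ν (ζ k ω))) / charFun ν (ζ n ω) *
          Complex.exp (ζ n ω * ξ n ω * Complex.I) ∂μ := by
          refine integral_congr_ae (ae_of_all _ fun ω => ?_)
          simp only [Finset.prod_range_succ]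
          ring
      _ = _ := key
      _ = _ := by
          rw [← ih]
          refine integral_congr_ae (ae_of_all _ fun ω => ?_)
          have : charFun ν (ζ n ω) ≠ 0 := fun h0 => by
            have := hφ n ω
            rw [h0, norm_zero] at this
            norm_num at this
          simp only
          rw [div_mul_cancel₀ _ this]

/-- Both functions equal `1 - s x² / 2 + o(x²)` at the origin. -/
theorem exists_norm_charFun_sub_exp_le {ξ : Ω → ℝ} (hξ : MemLp ξ 2 μ) (h0 : ∫ ω, ξ ω ∂μ = 0)
    {ε : ℝ} (hε : 0 < ε) :
    ∃ r > 0, ∀ x : ℝ, |x| ≤ r → ‖charFun (μ.map ξ) x -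
      (Real.exp (-((∫ ω, ξ ω ^ 2 ∂μ) / 2 * x ^ 2)) : ℝ)‖ ≤ ε * x ^ 2 := by
  set s := ∫ ω, ξ ω ^ 2 ∂μ with hs
  have hm := hξ.aestronglyMeasurable.aemeasurable
  have hP : IsProbabilityMeasure (μ.map ξ) := Measure.isProbabilityMeasure_map hm
  have hmem : MemLp id 2 (μ.map ξ) := by
    rw [memLp_map_measure_iff aestronglyMeasurable_id hm]
    simpa using hξ
  have h1 : (fun t => charFun (μ.map ξ) t - (1 - (s : ℂ) * t ^ 2 / 2)) =o[𝓝 0]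
      fun t : ℝ => t ^ 2 := by
    have h2 : ∀ t : ℝ, taylorWithinEval (charFun (μ.map ξ)) 2 Set.univ 0 t =
        1 - (s : ℂ) * t ^ 2 / 2 := fun t => by
      rw [taylorWithinEval_charFun_two_zero hm hmem, h0, hs]
      simp
    simp_rw [← h2]
    have := taylor_isLittleO_univ (n := 2) (x₀ := (0 : ℝ)) (contDiff_charFun (n := 2) hmem)
    simpa using this
  have h3 : (fun t : ℝ => (Real.exp (-(s / 2 * t ^ 2)) - (1 - s * t ^ 2 / 2) : ℝ)) =o[𝓝 0]
      fun t : ℝ => t ^ 2 := by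
    have ht : Tendsto (fun t : ℝ => -(s / 2 * t ^ 2)) (𝓝 0) (𝓝 0) := by
      have : Continuous fun t : ℝ => -(s / 2 * t ^ 2) := by fun_prop
      simpa using this.tendsto 0
    have h4 := (Real.hasDerivAt_exp 0).isLittleO.comp_tendsto ht
    have h5 : (fun t : ℝ => -(s / 2 * t ^ 2) - 0) =O[𝓝 0] fun t : ℝ => t ^ 2 :=
      Asymptotics.IsBigO.of_bound |s / 2| (Eventually.of_forall fun t => by
        simp [abs_div])
    refine (h4.trans_isBigO h5).congr_left fun t => ?_
    simp
    ring
  have h6 := (h1.sub (Complex.isLittleO_ofReal_left.2 h3)).def hε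
  obtain ⟨r, hr, hr'⟩ := Metric.eventually_nhds_iff_ball.1 h6
  refine ⟨r / 2, half_pos hr, fun x hx => ?_⟩
  have := hr' x (by rw [mem_ball_zero_iff, Real.norm_eq_abs]; linarith)
  rw [Real.norm_of_nonneg (sq_nonneg x)] at this
  refine le_trans (le_of_eq ?_) this
  congr 1
  push_cast
  ring

/-- A central limit theorem for weighted sums `∑_k c_k η_k ξ_k` of martingale differences, with
i.i.d. centered `ξ_k` independent of the past and bounded predictable `η_k`. -/
theorem tendsto_integral_cexp_sum {F : ℕ → MeasurableSpace Ω} (hF : ∀ k, F k ≤ mΩ)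
    (hmono : Monotone F) {ξ η : ℕ → Ω → ℝ} (hξ : ∀ k, Measurable[F (k + 1)] (ξ k))
    (hη : ∀ k, Measurable[F k] (η k))
    (hind : ∀ k, Indep (F k) (MeasurableSpace.comap (ξ k) inferInstance) μ)
    (hid : ∀ k, IdentDistrib (ξ k) (ξ 0) μ μ) (hL2 : MemLp (ξ 0) 2 μ) (h0 : ∫ ω, ξ 0 ω ∂μ = 0)
    {B : ℝ} (hB : ∀ k ω, |η k ω| ≤ B) {n : ℕ → ℕ} {c : ℕ → ℕ → ℝ} {m : ℕ → ℝ} {C v : ℝ}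
    (hcm : ∀ᶠ N in atTop, ∀ k, |c N k| ≤ m N) (hm : Tendsto m atTop (𝓝 0))
    (hC : ∀ᶠ N in atTop, ∑ k ∈ Finset.range (n N), c N k ^ 2 ≤ C) (hv : 0 ≤ v)
    (hlln : Tendsto (fun N => ∫ ω, |∑ k ∈ Finset.range (n N), c N k ^ 2 * η k ω ^ 2 - v| ∂μ)
      atTop (𝓝 0)) :
    Tendsto (fun N => ∫ ω, Complex.exp ((∑ k ∈ Finset.range (n N), c N k * η k ω * ξ k ω : ℝ) *
      Complex.I) ∂μ) atTop (𝓝 (Real.exp (-((∫ ω, ξ 0 ω ^ 2 ∂μ) / 2 * v)) : ℝ)) := by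
  set s := ∫ ω, ξ 0 ω ^ 2 ∂μ with hs
  have hs0 : 0 ≤ s := integral_nonneg fun ω => sq_nonneg _
  have hξm : ∀ k, Measurable (ξ k) := fun k => (hξ k).mono (hF _) le_rfl
  have hηm : ∀ k, Measurable (η k) := fun k => (hη k).mono (hF _) le_rfl
  have hP : IsProbabilityMeasure (μ.map (ξ 0)) :=
    Measure.isProbabilityMeasure_map (hξm 0).aemeasurable
  obtain ⟨ω₀⟩ : Nonempty Ω := nonempty_of_isProbabilityMeasure μ
  have hB0 : 0 ≤ B := (abs_nonneg _).trans (hB 0 ω₀)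
  have hC0 : 0 ≤ C := by
    obtain ⟨N, hN⟩ := hC.exists
    exact (Finset.sum_nonneg fun k _ => sq_nonneg _).trans hN
  set φ := charFun (μ.map (ξ 0)) with hφ
  have hφm : Measurable φ := continuous_charFun.measurable
  obtain ⟨r₀, hr₀, hr₀'⟩ : ∃ r > 0, ∀ x : ℝ, |x| ≤ r → 1 / 2 ≤ ‖φ x‖ := by
    have h1 : Tendsto (fun x => ‖φ x‖) (𝓝 0) (𝓝 1) := by
      have := (continuous_charFun (μ := μ.map (ξ 0))).norm.tendsto 0
      simpa using this
    obtain ⟨r, hr, hr'⟩ := Metric.eventually_nhds_iff_ball.1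
      (h1.eventually_const_le (show (1 / 2 : ℝ) < 1 by norm_num))
    exact ⟨r / 2, half_pos hr, fun x hx => hr' x (by
      rw [mem_ball_zero_iff, Real.norm_eq_abs]; linarith)⟩
  -- Half the smallest possible value of the Gaussian factor. If the approximation error `ε B² C` is
  -- at most `ρ`, the product `Q` below stays above `ρ` in norm, so `P = exp(i S) / Q` is bounded by
  -- `ρ⁻¹` uniformly in `N`.
  set ρ := Real.exp (-(s / 2 * (B ^ 2 * C))) / 2 with hρ
  have hρ0 : 0 < ρ := by positivity
  have hmB : Tendsto (fun N => m N * B) atTop (𝓝 0) := by simpa using hm.mul_const B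
  have main : ∀ ε > 0, ε * (B ^ 2 * C) ≤ ρ → ∀ᶠ N in atTop,
      ‖∫ ω, Complex.exp ((∑ k ∈ Finset.range (n N), c N k * η k ω * ξ k ω : ℝ) *
      Complex.I) ∂μ - (Real.exp (-(s / 2 * v)) : ℝ)‖ ≤ ρ⁻¹ * (ε * (B ^ 2 * C) + s / 2 *
        ∫ ω, |∑ k ∈ Finset.range (n N), c N k ^ 2 * η k ω ^ 2 - v| ∂μ) := by
    intro ε hε hερ
    obtain ⟨r, hr, hr'⟩ := exists_norm_charFun_sub_exp_le hL2 h0 hε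
    filter_upwards [hcm, hC, hmB.eventually_le_const hr, hmB.eventually_le_const hr₀] with
      N hcN hCN hrN hr₀N
    set ζ : ℕ → Ω → ℝ := fun k ω => c N k * η k ω with hζ
    have hζB : ∀ k ω, |ζ k ω| ≤ m N * B := fun k ω => by
      rw [hζ, abs_mul]
      exact mul_le_mul (hcN k) (hB k ω) (abs_nonneg _) ((abs_nonneg _).trans (hcN k))
    have hφ2 : ∀ k ω, 1 / 2 ≤ ‖φ (ζ k ω)‖ := fun k ω => hr₀' _ ((hζB k ω).trans hr₀N)
    set P : Ω → ℂ := fun ω => ∏ k ∈ Finset.range (n N),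
      (Complex.exp (ζ k ω * ξ k ω * Complex.I) / φ (ζ k ω)) with hPdef
    set Q : Ω → ℂ := fun ω => ∏ k ∈ Finset.range (n N), φ (ζ k ω) with hQ
    set T : Ω → ℝ := fun ω => ∑ k ∈ Finset.range (n N), c N k ^ 2 * η k ω ^ 2 with hT
    have hζm : ∀ k, Measurable (ζ k) := fun k => (hηm k).const_mul _
    have hPm : Measurable P := by
      refine Finset.measurable_fun_prod _ fun k _ => ?_
      have := hζm k
      have := hξm k
      exact Measurable.div (by fun_prop) (hφm.comp (hζm k))
    have hQm : Measurable Q := Finset.measurable_fun_prod _ fun k _ => hφm.comp (hζm k)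
    have hTm : Measurable T := Finset.measurable_fun_sum _ fun k _ =>
      ((hηm k).pow_const 2).const_mul _
    have hP1 : ∫ ω, P ω ∂μ = 1 := integral_prod_cexp_div_charFun hF hmono hξ
      (fun k => (hη k).const_mul (c N k)) hind (fun k => (hid k).map_eq) hφ2 _
    have hT0 : ∀ ω, 0 ≤ T ω := fun ω => Finset.sum_nonneg fun k _ => by positivity
    have hTC : ∀ ω, T ω ≤ B ^ 2 * C := fun ω => by
      calc T ω ≤ ∑ k ∈ Finset.range (n N), c N k ^ 2 * B ^ 2 := by
            refine Finset.sum_le_sum fun k _ => mul_le_mul_of_nonneg_left ?_ (sq_nonneg _)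
            rw [← sq_abs]
            exact pow_le_pow_left₀ (abs_nonneg _) (hB k ω) 2
        _ = B ^ 2 * ∑ k ∈ Finset.range (n N), c N k ^ 2 := by rw [← Finset.sum_mul, mul_comm]
        _ ≤ _ := by gcongr
    have hQT : ∀ ω, ‖Q ω - (Real.exp (-(s / 2 * T ω)) : ℝ)‖ ≤ ε * (B ^ 2 * C) := fun ω => by
      have h1 : ((Real.exp (-(s / 2 * T ω)) : ℝ) : ℂ) = ∏ k ∈ Finset.range (n N),
          ((Real.exp (-(s / 2 * ζ k ω ^ 2)) : ℝ) : ℂ) := by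
        rw [← Complex.ofReal_prod, ← Real.exp_sum, Finset.sum_neg_distrib, ← Finset.mul_sum]
        simp only [hT, hζ, mul_pow]
      rw [h1]
      refine (norm_prod_sub_prod_le _ _ _ (fun k _ => norm_charFun_le_one _) fun k _ => ?_).trans ?_
      · rw [Complex.norm_real, Real.norm_of_nonneg (Real.exp_pos _).le, Real.exp_le_one_iff]
        exact neg_nonpos.2 (by positivity)
      · calc _ ≤ ∑ k ∈ Finset.range (n N), ε * ζ k ω ^ 2 :=
              Finset.sum_le_sum fun k _ => hr' _ ((hζB k ω).trans hrN)
          _ = ε * T ω := by rw [← Finset.mul_sum]; simp only [hT, hζ, mul_pow]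
          _ ≤ _ := by gcongr; exact hTC ω
    have hQρ : ∀ ω, ρ ≤ ‖Q ω‖ := fun ω => by
      have h1 : 2 * ρ ≤ Real.exp (-(s / 2 * T ω)) := by
        rw [hρ, mul_div_cancel₀ _ two_ne_zero]
        have := hTC ω
        gcongr
      have h2 := norm_sub_norm_le ((Real.exp (-(s / 2 * T ω)) : ℝ) : ℂ) (Q ω)
      rw [norm_sub_rev, Complex.norm_real, Real.norm_of_nonneg (Real.exp_pos _).le] at h2
      linarith [hQT ω]
    have hPQ : ∀ ω, P ω * Q ω = Complex.exp ((∑ k ∈ Finset.range (n N),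
        c N k * η k ω * ξ k ω : ℝ) * Complex.I) := fun ω => by
      rw [hPdef, hQ, ← Finset.prod_mul_distrib, Complex.ofReal_sum, Finset.sum_mul,
        Complex.exp_sum]
      refine Finset.prod_congr rfl fun k _ => ?_
      have : φ (ζ k ω) ≠ 0 := fun h => by
        have := hφ2 k ω
        rw [h, norm_zero] at this
        norm_num at this
      rw [div_mul_cancel₀ _ this]
      simp [hζ]
    have hPρ : ∀ ω, ‖P ω‖ ≤ ρ⁻¹ := fun ω => by
      have h1 : ‖P ω‖ * ‖Q ω‖ = 1 := by
        rw [← norm_mul, hPQ, Complex.norm_exp_ofReal_mul_I]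
      rw [eq_one_div_of_mul_eq_one_left h1, one_div]
      exact inv_anti₀ hρ0 (hQρ ω)
    have hIPQ : Integrable (fun ω => P ω * Q ω) μ := by
      refine Integrable.of_bound (hPm.mul hQm).aestronglyMeasurable 1 (ae_of_all _ fun ω => ?_)
      rw [hPQ, Complex.norm_exp_ofReal_mul_I]
    have hIP : Integrable P μ :=
      Integrable.of_bound hPm.aestronglyMeasurable ρ⁻¹ (ae_of_all _ hPρ)
    have hIT : Integrable (fun ω => |T ω - v|) μ :=
      ((Integrable.of_bound hTm.aestronglyMeasurable (B ^ 2 * C) (ae_of_all _ fun ω => by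
        rw [Real.norm_of_nonneg (hT0 ω)]; exact hTC ω)).sub (integrable_const v)).abs
    -- This is where `E P = 1` enters: the error becomes `E P (Q - exp(-s v / 2))`, with `P` bounded
    -- and the second factor small in `L¹`.
    have hint : ∫ ω, Complex.exp ((∑ k ∈ Finset.range (n N), c N k * η k ω * ξ k ω : ℝ) *
        Complex.I) ∂μ - (Real.exp (-(s / 2 * v)) : ℝ) =
        ∫ ω, P ω * (Q ω - (Real.exp (-(s / 2 * v)) : ℝ)) ∂μ := by
      simp_rw [← hPQ, mul_sub]
      rw [integral_sub hIPQ (hIP.mul_const _), integral_mul_const, hP1, one_mul]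
    rw [hint]
    calc _ ≤ ∫ ω, ρ⁻¹ * (ε * (B ^ 2 * C) + s / 2 * |T ω - v|) ∂μ := by
          refine norm_integral_le_of_norm_le (((integrable_const _).add
            (hIT.const_mul _)).const_mul _) (ae_of_all _ fun ω => ?_)
          rw [norm_mul]
          gcongr
          · exact hPρ ω
          · calc _ = ‖(Q ω - (Real.exp (-(s / 2 * T ω)) : ℝ)) +
                  (((Real.exp (-(s / 2 * T ω)) - Real.exp (-(s / 2 * v)) : ℝ)) : ℂ)‖ := by
                  congr 1; push_cast; ring
              _ ≤ _ := norm_add_le _ _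
              _ ≤ ε * (B ^ 2 * C) + |s / 2 * T ω - s / 2 * v| := by
                  rw [Complex.norm_real]
                  exact add_le_add (hQT ω) (abs_exp_neg_sub_exp_neg_le
                    (mul_nonneg (by positivity) (hT0 ω)) (by positivity))
              _ = _ := by rw [← mul_sub, abs_mul, abs_of_nonneg (by positivity : 0 ≤ s / 2)]
      _ = _ := by
          rw [integral_const_mul, integral_add (integrable_const _) (hIT.const_mul _),
            integral_const_mul (s / 2)]
          simp [hT]
  rw [tendsto_iff_norm_sub_tendsto_zero]
  refine tendsto_order.2 ⟨fun a ha => Eventually.of_forall fun N => ha.trans_le (norm_nonneg _),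
    fun a ha => ?_⟩
  set D := B ^ 2 * C with hD
  have hD0 : 0 ≤ D := by positivity
  -- The first entry gives `ε D ≤ ρ`, the second `ρ⁻¹ ε D ≤ a / 2`; `D + 1` covers `D = 0`.
  set ε := min (ρ / (D + 1)) (ρ * (a / 2) / (D + 1)) with hε
  have hε0 : 0 < ε := lt_min (by positivity) (by positivity)
  have hεD : ∀ x, 0 ≤ x → ε ≤ x / (D + 1) → ε * D ≤ x := fun x hx h => by
    have : ε * (D + 1) ≤ x := (le_div_iff₀ (by positivity)).1 h
    nlinarith
  have hlim : Tendsto (fun N => ρ⁻¹ * (ε * D + s / 2 *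
      ∫ ω, |∑ k ∈ Finset.range (n N), c N k ^ 2 * η k ω ^ 2 - v| ∂μ)) atTop
      (𝓝 (ρ⁻¹ * (ε * D + s / 2 * 0))) := (tendsto_const_nhds.add (hlln.const_mul _)).const_mul _
  have hlt : ρ⁻¹ * (ε * D + s / 2 * 0) < a := by
    have := hεD _ (by positivity) (min_le_right _ _)
    rw [mul_zero, add_zero, inv_mul_lt_iff₀ hρ0]
    nlinarith
  filter_upwards [main ε hε0 (hεD _ hρ0.le (min_le_left _ _)), hlim.eventually_lt_const hlt] with
    N h1 h2 using h1.trans_lt h2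

end CentralLimit

/-! ### A weak law for weighted sums -/

section LawOfLargeNumbers

variable {Ω : Type*} {mΩ : MeasurableSpace Ω} {μ : Measure Ω} [IsProbabilityMeasure μ]

/-- A weak law of large numbers for weighted sums of bounded variables whose covariances vanish at
large lags. -/
theorem tendsto_integral_abs_weighted_sum {G : ℕ → Ω → ℝ} {B : ℝ} (hG : ∀ k, AEMeasurable (G k) μ)
    (hB : ∀ k ω, |G k ω| ≤ B)
    (hcov : ∀ δ > 0, ∃ M : ℕ, ∀ k l, k + M ≤ l → ∫ ω, G k ω * G l ω ∂μ ≤ δ)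
    {n : ℕ → ℕ} {d : ℕ → ℕ → ℝ} {m : ℕ → ℝ} {C : ℝ} (hd0 : ∀ᶠ N in atTop, ∀ k, 0 ≤ d N k)
    (hdm : ∀ᶠ N in atTop, ∀ k, d N k ≤ m N) (hm : Tendsto m atTop (𝓝 0))
    (hC : ∀ᶠ N in atTop, ∑ k ∈ Finset.range (n N), d N k ≤ C) :
    Tendsto (fun N => ∫ ω, |∑ k ∈ Finset.range (n N), d N k * G k ω| ∂μ) atTop (𝓝 0) := by
  obtain ⟨ω₀⟩ : Nonempty Ω := nonempty_of_isProbabilityMeasure μ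
  have hB0 : 0 ≤ B := (abs_nonneg _).trans (hB 0 ω₀)
  have hI : ∀ k l, Integrable (fun ω => G k ω * G l ω) μ := fun k l =>
    Integrable.of_bound ((hG k).mul (hG l)).aestronglyMeasurable (B * B) (ae_of_all _ fun ω => by
      rw [norm_mul]
      exact mul_le_mul (hB k ω) (hB l ω) (norm_nonneg _) hB0)
  have hI1 : ∀ k, Integrable (G k) μ := fun k =>
    Integrable.of_bound (hG k).aestronglyMeasurable B (ae_of_all _ (hB k))
  have hIB : ∀ k l, ∫ ω, G k ω * G l ω ∂μ ≤ B * B := fun k l => by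
    have := integral_mono (hI k l) (integrable_const (B * B)) fun ω => by
      refine (le_abs_self _).trans ?_
      rw [abs_mul]
      exact mul_le_mul (hB k ω) (hB l ω) (abs_nonneg _) hB0
    simpa using this
  have key : ∀ δ > 0, ∃ M : ℕ, ∀ᶠ N in atTop,
      ∫ ω, (∑ k ∈ Finset.range (n N), d N k * G k ω) ^ 2 ∂μ ≤
        δ * C ^ 2 + B * B * (C * (2 * M * m N)) := by
    intro δ hδ
    obtain ⟨M, hM⟩ := hcov δ hδ
    refine ⟨M, ?_⟩
    filter_upwards [hd0, hdm, hC] with N hd0 hdm hC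
    set s := Finset.range (n N)
    have hm0 : 0 ≤ m N := (hd0 0).trans (hdm 0)
    have hC0 : 0 ≤ C := (Finset.sum_nonneg fun k _ => hd0 k).trans hC
    -- Off a diagonal band the covariance is at most `δ`; inside it the crude bound `B²` is enough,
    -- as each row of the band has at most `2 M` entries of weight at most `m N`. Truncated
    -- subtraction in `k + 1 - M` is harmless: no index lies below `0`.
    have hkl : ∀ k l, ∫ ω, G k ω * G l ω ∂μ ≤
        δ + B * B * (if l ∈ Finset.Ico (k + 1 - M) (k + M) then 1 else 0) := by
      intro k l
      split_ifs with h
      · have := hIB k l; linarith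
      · rw [Finset.mem_Ico, not_and_or] at h
        rw [mul_zero, add_zero]
        rcases h with h | h
        · simp_rw [mul_comm (G k _)]
          exact hM l k (by omega)
        · exact hM k l (by omega)
    have hcard : ∀ k, ∑ l ∈ s, d N l * (if l ∈ Finset.Ico (k + 1 - M) (k + M) then 1 else 0) ≤
        2 * M * m N := by
      intro k
      simp only [mul_ite, mul_one, mul_zero]
      rw [← Finset.sum_filter]
      calc _ ≤ ∑ l ∈ s with l ∈ Finset.Ico (k + 1 - M) (k + M), m N :=
            Finset.sum_le_sum fun l _ => hdm l
        _ = (s.filter (· ∈ Finset.Ico (k + 1 - M) (k + M))).card * m N := by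
            rw [Finset.sum_const, nsmul_eq_mul]
        _ ≤ (2 * M : ℕ) * m N := by
            gcongr
            refine (Finset.card_le_card (t := Finset.Ico (k + 1 - M) (k + M)) fun l hl =>
              (Finset.mem_filter.1 hl).2).trans ?_
            rw [Nat.card_Ico]
            omega
        _ = _ := by push_cast; ring
    calc ∫ ω, (∑ k ∈ s, d N k * G k ω) ^ 2 ∂μ
        = ∑ k ∈ s, ∑ l ∈ s, d N k * (d N l * ∫ ω, G k ω * G l ω ∂μ) := by
          have : ∀ ω, (∑ k ∈ s, d N k * G k ω) ^ 2 =
              ∑ k ∈ s, ∑ l ∈ s, d N k * (d N l * (G k ω * G l ω)) := fun ω => by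
            rw [sq, Finset.sum_mul_sum]
            exact Finset.sum_congr rfl fun k _ => Finset.sum_congr rfl fun l _ => by ring
          simp_rw [this]
          rw [integral_finsetSum _ fun k _ => integrable_finsetSum _ fun l _ =>
            ((hI k l).const_mul _).const_mul _]
          refine Finset.sum_congr rfl fun k _ => ?_
          rw [integral_finsetSum _ fun l _ => ((hI k l).const_mul _).const_mul _]
          simp only [integral_const_mul]
      _ ≤ ∑ k ∈ s, ∑ l ∈ s, d N k * (d N l *
            (δ + B * B * (if l ∈ Finset.Ico (k + 1 - M) (k + M) then 1 else 0))) :=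
          Finset.sum_le_sum fun k _ => Finset.sum_le_sum fun l _ =>
            mul_le_mul_of_nonneg_left (mul_le_mul_of_nonneg_left (hkl k l) (hd0 l)) (hd0 k)
      _ = ∑ k ∈ s, d N k * (δ * ∑ l ∈ s, d N l + B * B *
            ∑ l ∈ s, d N l * (if l ∈ Finset.Ico (k + 1 - M) (k + M) then 1 else 0)) := by
          refine Finset.sum_congr rfl fun k _ => ?_
          rw [← Finset.mul_sum]
          congr 1
          rw [Finset.mul_sum, Finset.mul_sum, ← Finset.sum_add_distrib]
          exact Finset.sum_congr rfl fun l _ => by ring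
      _ ≤ ∑ k ∈ s, d N k * (δ * C + B * B * (2 * M * m N)) := by
          refine Finset.sum_le_sum fun k _ => mul_le_mul_of_nonneg_left ?_ (hd0 k)
          have := hcard k
          gcongr
      _ = (∑ k ∈ s, d N k) * (δ * C + B * B * (2 * M * m N)) := by rw [Finset.sum_mul]
      _ ≤ C * (δ * C + B * B * (2 * M * m N)) := by gcongr
      _ = _ := by ring
  have hsq : Tendsto (fun N => ∫ ω, (∑ k ∈ Finset.range (n N), d N k * G k ω) ^ 2 ∂μ) atTop
      (𝓝 0) := by
    refine tendsto_order.2 ⟨fun a ha => Eventually.of_forall fun N =>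
      ha.trans_le (integral_nonneg fun ω => sq_nonneg _), fun a ha => ?_⟩
    obtain ⟨M, hM⟩ := key (a / 2 / (C ^ 2 + 1)) (by positivity)
    have hlim : Tendsto (fun N => a / 2 / (C ^ 2 + 1) * C ^ 2 + B * B * (C * (2 * M * m N))) atTop
        (𝓝 (a / 2 / (C ^ 2 + 1) * C ^ 2 + B * B * (C * (2 * M * 0)))) :=
      tendsto_const_nhds.add (((hm.const_mul _).const_mul _).const_mul _)
    have hlt : a / 2 / (C ^ 2 + 1) * C ^ 2 + B * B * (C * (2 * M * 0)) < a := by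
      have : a / 2 / (C ^ 2 + 1) * (C ^ 2 + 1) = a / 2 := div_mul_cancel₀ _ (by positivity)
      have h2 : 0 < a / 2 / (C ^ 2 + 1) := by positivity
      nlinarith
    filter_upwards [hM, hlim.eventually_lt_const hlt] with N h1 h2 using h1.trans_lt h2
  refine tendsto_order.2 ⟨fun a ha => Eventually.of_forall fun N =>
    ha.trans_le (integral_nonneg fun ω => abs_nonneg _), fun a ha => ?_⟩
  filter_upwards [hsq.eventually_lt_const (show 0 < a * a / 4 by positivity)] with N hN
  have hS : Integrable (fun ω => ∑ k ∈ Finset.range (n N), d N k * G k ω) μ :=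
    integrable_finsetSum _ fun k _ => (hI1 k).const_mul _
  have hS2 : Integrable (fun ω => (∑ k ∈ Finset.range (n N), d N k * G k ω) ^ 2) μ := by
    have : ∀ ω, (∑ k ∈ Finset.range (n N), d N k * G k ω) ^ 2 =
        ∑ k ∈ Finset.range (n N), ∑ l ∈ Finset.range (n N), d N k * d N l * (G k ω * G l ω) :=
      fun ω => by
        rw [sq, Finset.sum_mul_sum]
        exact Finset.sum_congr rfl fun k _ => Finset.sum_congr rfl fun l _ => by ring
    simp_rw [this]
    exact integrable_finsetSum _ fun k _ => integrable_finsetSum _ fun l _ =>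
      (hI k l).const_mul _
  -- The pointwise inequality `|x| ≤ a/2 + x² / (a/2)` passes from second to first moments.
  calc _ ≤ ∫ ω, (a / 2 + (a / 2)⁻¹ * (∑ k ∈ Finset.range (n N), d N k * G k ω) ^ 2) ∂μ := by
        refine integral_mono hS.abs ((integrable_const _).add (hS2.const_mul _)) fun ω => ?_
        simp only
        set x := ∑ k ∈ Finset.range (n N), d N k * G k ω
        have h1 : (a / 2) * (a / 2)⁻¹ = 1 := mul_inv_cancel₀ (by positivity)
        have h2 : 0 < (a / 2)⁻¹ := by positivity
        rw [← sq_abs x]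
        nlinarith [sq_nonneg (|x| - a / 2), abs_nonneg x,
          mul_nonneg h2.le (sq_nonneg (|x| - a / 2))]
    _ = a / 2 + (a / 2)⁻¹ * ∫ ω, (∑ k ∈ Finset.range (n N), d N k * G k ω) ^ 2 ∂μ := by
        rw [integral_add (integrable_const _) (hS2.const_mul _), integral_const_mul]
        simp
    _ < a / 2 + (a / 2)⁻¹ * (a * a / 4) := by gcongr
    _ = a := by field_simp; ring

end LawOfLargeNumbers

/-! ### Riemann sums of almost everywhere continuous functions -/

section RiemannSum

theorem integral_comp_floor {g : ℤ → ℝ} {S : Finset ℤ} (hS : ∀ j ∉ S, g j = 0) :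
    ∫ y : ℝ, g ⌊y⌋ = ∑ j ∈ S, g j := by
  have h1 : ∀ y : ℝ, g ⌊y⌋ = ∑ j ∈ S, (Set.Ico (j : ℝ) (j + 1)).indicator (fun _ => g j) y := by
    intro y
    have h2 : ∀ j ∈ S, (Set.Ico (j : ℝ) (j + 1)).indicator (fun _ => g j) y =
        if j = ⌊y⌋ then g j else 0 := fun j _ => by
      rw [Set.indicator_apply]
      congr 1
      rw [Set.mem_Ico, eq_comm (a := j), Int.floor_eq_iff]
    rw [Finset.sum_congr rfl h2, Finset.sum_ite_eq']
    split_ifs with h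
    · rfl
    · exact hS _ h
  simp_rw [h1]
  rw [integral_finsetSum _ fun j _ => (integrable_indicator_iff measurableSet_Ico).2
    (integrableOn_const (by simp))]
  refine Finset.sum_congr rfl fun j _ => ?_
  rw [integral_indicator measurableSet_Ico, setIntegral_const]
  simp [Measure.real]

theorem tendsto_integral_comp_floor {f : ℝ → ℝ} {K : ℝ} (hK : ∀ x, |f x| ≤ K)
    (hsupp : ∀ x, x ∉ Set.Icc (-1 / 2 : ℝ) (1 / 2) → f x = 0) (hcont : ∀ᵐ x, ContinuousAt f x)
    {h : ℕ → ℝ} (h0 : ∀ᶠ N in atTop, 0 < h N) (hlim : Tendsto h atTop (𝓝 0)) :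
    Tendsto (fun N => ∫ x : ℝ, f (h N * ⌊x / h N⌋)) atTop (𝓝 (∫ x, f x)) := by
  have hK0 : 0 ≤ K := (abs_nonneg _).trans (hK 0)
  have hdist : ∀ {e : ℝ}, 0 < e → ∀ x : ℝ, x - e ≤ e * ⌊x / e⌋ ∧ e * ⌊x / e⌋ ≤ x := by
    intro e he x
    have h1 := Int.lt_floor_add_one (x / e)
    have h2 := Int.floor_le (x / e)
    have h3 : e * (x / e) = x := mul_div_cancel₀ _ he.ne'
    constructor <;> nlinarith
  -- The grid point `h ⌊x/h⌋` lies within `h` of `x`. Once `h ≤ 1/2`, the step functions vanish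
  -- outside `[-1, 1]`.
  refine tendsto_integral_filter_of_dominated_convergence
    ((Set.Icc (-1 : ℝ) 1).indicator fun _ => K) (Eventually.of_forall fun N => ?_) ?_ ?_ ?_
  · exact ((measurable_of_countable fun j : ℤ => f (h N * j)).comp
      (Int.measurable_floor.comp (measurable_id.div_const _))).aestronglyMeasurable
  · filter_upwards [h0, hlim.eventually_le_const (show (0 : ℝ) < 1 / 2 by norm_num)] with N h0 h1
    refine ae_of_all _ fun x => ?_
    rw [Set.indicator_apply]
    split_ifs with hx
    · exact hK _
    · rw [hsupp, norm_zero]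
      intro hx'
      have := hdist h0 x
      exact hx ⟨by linarith [hx'.1], by linarith [hx'.2]⟩
  · exact (integrable_indicator_iff measurableSet_Icc).2 (integrableOn_const (by simp))
  · filter_upwards [hcont] with x hx
    refine hx.tendsto.comp ?_
    refine tendsto_of_tendsto_of_tendsto_of_le_of_le' (g := fun N => x - h N) (h := fun _ => x)
      ?_ tendsto_const_nhds ?_ ?_
    · simpa using hlim.const_sub x
    · filter_upwards [h0] with N h0 using (hdist h0 x).1
    · filter_upwards [h0] with N h0 using (hdist h0 x).2

/-- After the scaling `x = h y`, the integral of the step function is the full lattice sum. `hrange`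
ensures that the index range `[q, N]` loses no nonzero term. -/
theorem tendsto_riemannSum {f : ℝ → ℝ} {K : ℝ} (hK : ∀ x, |f x| ≤ K)
    (hsupp : ∀ x, x ∉ Set.Icc (-1 / 2 : ℝ) (1 / 2) → f x = 0) (hcont : ∀ᵐ x, ContinuousAt f x)
    {h : ℕ → ℝ} (h0 : ∀ᶠ N in atTop, 0 < h N) (hlim : Tendsto h atTop (𝓝 0)) {q : ℕ} {t : ℕ → ℕ}
    (hrange : ∀ᶠ N in atTop, ∀ j : ℤ, |h N * j| ≤ 1 / 2 → q ≤ t N - j ∧ t N - j ≤ N) :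
    Tendsto (fun N => ∑ k ∈ Finset.Icc q N, h N * f (h N * (t N - k))) atTop
      (𝓝 (∫ x in (-1 / 2 : ℝ)..(1 / 2), f x)) := by
  have h1 : ∫ x in (-1 / 2 : ℝ)..(1 / 2), f x = ∫ x, f x := by
    rw [intervalIntegral.integral_of_le (by norm_num), ← integral_Icc_eq_integral_Ioc,
      setIntegral_eq_integral_of_forall_compl_eq_zero hsupp]
  rw [h1]
  refine (tendsto_integral_comp_floor hK hsupp hcont h0 hlim).congr' ?_
  filter_upwards [h0, hrange] with N h0 hr
  rw [Measure.integral_comp_div (fun y => f (h N * ⌊y⌋)), abs_of_pos h0, smul_eq_mul,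
    integral_comp_floor (g := fun j => f (h N * j))
      (S := (Finset.Icc q N).image fun k : ℕ => (t N : ℤ) - k),
    Finset.sum_image fun a _ b _ hab => by simpa using hab, Finset.mul_sum]
  · push_cast
    rfl
  · intro j hj
    refine hsupp _ fun hmem => hj ?_
    have h2 := hr j (abs_le.2 ⟨by linarith [hmem.1], hmem.2⟩)
    exact Finset.mem_image.2 ⟨((t N : ℤ) - j).toNat, Finset.mem_Icc.2 ⟨by omega, by omega⟩, by omega⟩

theorem IsKernel.exists_bound {W : ℝ → ℝ} (hW : IsKernel W) : ∃ K : ℝ, ∀ x, |W x| ≤ K := by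
  set V := (eVariationOn W (Set.Icc (-1 / 2 : ℝ) (1 / 2))).toReal
  refine ⟨|W 0| + V, fun x => ?_⟩
  have hV : 0 ≤ V := ENNReal.toReal_nonneg
  by_cases hx : x ∈ Set.Icc (-1 / 2 : ℝ) (1 / 2)
  · have h1 := hW.boundedVariation.dist_le hx (y := 0) (by constructor <;> norm_num)
    change |W x - W 0| ≤ V at h1
    have h2 := abs_sub_abs_le_abs_sub (W x) (W 0)
    linarith
  · rw [hW.support x hx, abs_zero]
    positivity

/-- Bounded variation gives differentiability almost everywhere on the interval; off it `W` is
locally zero. -/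
theorem IsKernel.ae_continuousAt {W : ℝ → ℝ} (hW : IsKernel W) : ∀ᵐ x, ContinuousAt W x := by
  have h1 : BoundedVariationOn W (Set.uIcc (-1 / 2 : ℝ) (1 / 2)) := by
    rw [Set.uIcc_of_le (by norm_num)]
    exact hW.boundedVariation
  filter_upwards [h1.ae_differentiableAt_of_mem_uIcc] with x hx
  by_cases hmem : x ∈ Set.uIcc (-1 / 2 : ℝ) (1 / 2)
  · exact (hx hmem).continuousAt
  · rw [Set.uIcc_of_le (by norm_num)] at hmem
    have h2 : W =ᶠ[𝓝 x] fun _ => 0 := by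
      filter_upwards [isClosed_Icc.isOpen_compl.mem_nhds hmem] with y hy using hW.support y hy
    exact continuousAt_const.congr h2.symm

end RiemannSum

/-! ### Gradients of the quasi-likelihood -/

section Gradient

variable {p : ℕ} {x : ℤ → ℝ} {t : ℤ} {α θ : Param p}

/-- The gradient `(1, x_{t-1}², …, x_{t-p}²)` of the linear form `archForm x t`. -/
noncomputable def archGrad (p : ℕ) (x : ℤ → ℝ) (t : ℤ) : Param p :=
  WithLp.toLp 2 (Fin.cons 1 fun j : Fin p => x (t - ((j : ℤ) + 1)) ^ 2)

theorem inner_archGrad (x : ℤ → ℝ) (t : ℤ) (θ : Param p) :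
    inner ℝ (archGrad p x t) θ = archForm x t θ := by
  simp [archGrad, archForm, PiLp.inner_apply, Fin.sum_univ_succ]

theorem archGrad_apply (x : ℤ → ℝ) (t : ℤ) (i : Fin (p + 1)) :
    archGrad p x t i = archForm x t (EuclideanSpace.single i 1) := by
  rw [← inner_archGrad, EuclideanSpace.inner_single_right]
  simp

theorem hasGradientAt_archForm (x : ℤ → ℝ) (t : ℤ) (α : Param p) :
    HasGradientAt (archForm x t) (archGrad p x t) α := by
  rw [hasGradientAt_iff_hasFDerivAt]
  refine (InnerProductSpace.toDual ℝ (Param p) (archGrad p x t)).hasFDerivAt.congr_of_eventuallyEq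
    (Eventually.of_forall fun θ => ?_)
  rw [InnerProductSpace.toDual_apply_apply, inner_archGrad]

theorem gradient_archForm (x : ℤ → ℝ) (t : ℤ) (α : Param p) :
    gradient (archForm x t) α = archGrad p x t :=
  (hasGradientAt_archForm x t α).gradient

theorem hasGradientAt_lik (h : archForm x t α ≠ 0) :
    HasGradientAt (lik x t) ((1 / 2 * ((archForm x t α)⁻¹ - x t ^ 2 / archForm x t α ^ 2)) •
      archGrad p x t) α := by
  rw [hasGradientAt_iff_hasFDerivAt, map_smul]
  have h1 : HasDerivAt (fun y : ℝ => 1 / 2 * (Real.log y + x t ^ 2 / y))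
      (1 / 2 * ((archForm x t α)⁻¹ - x t ^ 2 / archForm x t α ^ 2)) (archForm x t α) := by
    refine HasDerivAt.const_mul _ ?_
    simp only [div_eq_mul_inv (x t ^ 2)]
    exact ((Real.hasDerivAt_log h).fun_add ((hasDerivAt_inv h).const_mul (x t ^ 2))).congr_deriv
      (by ring)
  exact h1.comp_hasFDerivAt α (hasGradientAt_archForm x t α).hasFDerivAt

theorem gradient_weightedLik {W : ℝ → ℝ} {b : ℝ} {N t₀ : ℕ} (h : ∀ t, archForm x t α ≠ 0) :
    gradient (weightedLik W b N t₀ x) α = ∑ k ∈ Finset.Icc (p + 1) N,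
      (1 / (b * (N : ℝ)) * W (((t₀ : ℝ) - (k : ℝ)) / (b * (N : ℝ))) *
        (1 / 2 * ((archForm x k α)⁻¹ - x k ^ 2 / archForm x k α ^ 2))) • archGrad p x k := by
  refine HasGradientAt.gradient ?_
  rw [hasGradientAt_iff_hasFDerivAt, map_sum]
  refine HasFDerivAt.fun_sum fun k _ => ?_
  rw [mul_smul, map_smul]
  exact (hasGradientAt_lik (h k)).hasFDerivAt.const_mul _

end Gradient

/-! ### Quotients of affine forms: bounds and truncated Lipschitz estimates -/

section Ratio

variable {p : ℕ} {α θ : Param p}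

/-- The quotient of the affine forms with coefficients `θ` and `α`. -/
noncomputable def affineRatio (θ α : Param p) (v : Fin p → ℝ) : ℝ :=
  (θ 0 + ∑ j : Fin p, θ j.succ * v j) / (α 0 + ∑ j : Fin p, α j.succ * v j)

theorem affineRatio_lags (θ α : Param p) (x : ℤ → ℝ) (t : ℤ) :
    affineRatio θ α (lags p (fun s => x s ^ 2) t) = archForm x t θ / archForm x t α := rfl

theorem measurable_affineRatio (θ α : Param p) : Measurable (affineRatio θ α) := by
  unfold affineRatio
  fun_prop

theorem le_affine (hα : ∀ i, 0 < α i) {v : Fin p → ℝ} (hv : ∀ j, 0 ≤ v j) :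
    α 0 ≤ α 0 + ∑ j : Fin p, α j.succ * v j :=
  le_add_of_nonneg_right (Finset.sum_nonneg fun j _ => mul_nonneg (hα _).le (hv j))

/-- Coefficientwise `|θ i| ≤ B α i`, so on nonnegative vectors the numerator is dominated by `B`
times the denominator. This is where positivity of every coefficient of `α` is essential. -/
theorem exists_affineRatio_bounds (hα : ∀ i, 0 < α i) (θ : Param p) : ∃ B L : ℝ, 0 ≤ L ∧
    (∀ v, (∀ j, 0 ≤ v j) → |affineRatio θ α v| ≤ B) ∧
    ∀ v w, (∀ j, 0 ≤ v j) → (∀ j, 0 ≤ w j) →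
      |affineRatio θ α v - affineRatio θ α w| ≤ L * ∑ j, min 1 |v j - w j| := by
  set B := ∑ i, |θ i| / α i with hB
  have hterm : ∀ i ∈ (Finset.univ : Finset (Fin (p + 1))), 0 ≤ |θ i| / α i := fun i _ =>
    div_nonneg (abs_nonneg _) (hα i).le
  have hθ : ∀ i, |θ i| ≤ B * α i := fun i =>
    (div_le_iff₀ (hα i)).1 (Finset.single_le_sum hterm (Finset.mem_univ i))
  have hB0 : 0 ≤ B := Finset.sum_nonneg hterm
  have hbd : ∀ v, (∀ j, 0 ≤ v j) → |affineRatio θ α v| ≤ B := by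
    intro v hv
    have hw := (hα 0).trans_le (le_affine hα hv)
    rw [affineRatio, abs_div, abs_of_pos hw, div_le_iff₀ hw, mul_add, Finset.mul_sum]
    refine (abs_add_le _ _).trans (add_le_add (hθ 0) ?_)
    refine (Finset.abs_sum_le_sum_abs _ _).trans (Finset.sum_le_sum fun j _ => ?_)
    rw [abs_mul, abs_of_nonneg (hv j), ← mul_assoc]
    exact mul_le_mul_of_nonneg_right (hθ _) (hv j)
  set A := ∑ j : Fin p, α j.succ with hA
  have hA0 : 0 ≤ A := Finset.sum_nonneg fun j _ => (hα _).le
  -- The first summand of the constant serves increments that are all at most `1`, the second the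
  -- case of a larger one, where the truncated distance is at least `1`.
  refine ⟨B, 2 * B * A / α 0 + 2 * B, add_nonneg (div_nonneg (by positivity) (hα 0).le)
    (by positivity), hbd, fun v w hv hw => ?_⟩
  have hmin : ∀ j ∈ (Finset.univ : Finset (Fin p)), 0 ≤ min 1 |v j - w j| := fun j _ =>
    le_min zero_le_one (abs_nonneg _)
  have hS0 := Finset.sum_nonneg hmin
  have hLA : 0 ≤ 2 * B * A / α 0 := div_nonneg (by positivity) (hα 0).le
  by_cases h : ∀ j, |v j - w j| ≤ 1
  · have hwv := (hα 0).trans_le (le_affine hα hv)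
    have hww := (hα 0).trans_le (le_affine hα hw)
    have hdiff : affineRatio θ α v - affineRatio θ α w = (∑ j : Fin p, (θ j.succ -
        affineRatio θ α w * α j.succ) * (v j - w j)) / (α 0 + ∑ j : Fin p, α j.succ * v j) := by
      have h1 : ∑ j : Fin p, (θ j.succ - affineRatio θ α w * α j.succ) * (v j - w j) =
          (θ 0 + ∑ j : Fin p, θ j.succ * v j) - (θ 0 + ∑ j : Fin p, θ j.succ * w j) -
          affineRatio θ α w * ((α 0 + ∑ j : Fin p, α j.succ * v j) -
            (α 0 + ∑ j : Fin p, α j.succ * w j)) := by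
        rw [add_sub_add_left_eq_sub, add_sub_add_left_eq_sub, ← Finset.sum_sub_distrib,
          ← Finset.sum_sub_distrib, Finset.mul_sum, ← Finset.sum_sub_distrib]
        exact Finset.sum_congr rfl fun j _ => by ring
      have h2 : affineRatio θ α w * (α 0 + ∑ j : Fin p, α j.succ * w j) =
          θ 0 + ∑ j : Fin p, θ j.succ * w j := div_mul_cancel₀ _ hww.ne'
      rw [h1, eq_div_iff hwv.ne', sub_mul, mul_sub, h2]
      have h3 : affineRatio θ α v * (α 0 + ∑ j : Fin p, α j.succ * v j) =
          θ 0 + ∑ j : Fin p, θ j.succ * v j := div_mul_cancel₀ _ hwv.ne'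
      rw [h3]
      ring
    have hnum : |∑ j : Fin p, (θ j.succ - affineRatio θ α w * α j.succ) * (v j - w j)| ≤
        2 * B * A * ∑ j, min 1 |v j - w j| := by
      refine (Finset.abs_sum_le_sum_abs _ _).trans ?_
      rw [Finset.mul_sum]
      refine Finset.sum_le_sum fun j _ => ?_
      rw [abs_mul, min_eq_right (h j)]
      refine mul_le_mul_of_nonneg_right ?_ (abs_nonneg _)
      have h1 : α j.succ ≤ A :=
        Finset.single_le_sum (f := fun j : Fin p => α j.succ) (fun j _ => (hα _).le)
          (Finset.mem_univ j)
      calc _ ≤ |θ j.succ| + |affineRatio θ α w * α j.succ| := abs_sub _ _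
        _ ≤ B * α j.succ + B * α j.succ := by
            rw [abs_mul, abs_of_pos (hα _)]
            exact add_le_add (hθ _) (mul_le_mul_of_nonneg_right (hbd w hw) (hα _).le)
        _ = 2 * B * α j.succ := by ring
        _ ≤ 2 * B * A := by gcongr
    rw [hdiff, abs_div, abs_of_pos hwv]
    calc _ ≤ (2 * B * A * ∑ j, min 1 |v j - w j|) / α 0 := by
          have := le_affine hα hv
          exact div_le_div₀ (by positivity) hnum (hα 0) this
      _ = 2 * B * A / α 0 * ∑ j, min 1 |v j - w j| := by ring
      _ ≤ _ := by
          refine mul_le_mul_of_nonneg_right ?_ hS0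
          linarith
  · push Not at h
    obtain ⟨j, hj⟩ := h
    have h1 := Finset.single_le_sum hmin (Finset.mem_univ j)
    rw [min_eq_left hj.le] at h1
    calc _ ≤ |affineRatio θ α v| + |affineRatio θ α w| := abs_sub _ _
      _ ≤ 2 * B * 1 := by linarith [hbd v hv, hbd w hw]
      _ ≤ _ := mul_le_mul (by linarith) h1 zero_le_one (by linarith)

theorem exists_sq_affineRatio_bounds (hα : ∀ i, 0 < α i) (θ : Param p) : ∃ B L : ℝ, 0 ≤ L ∧
    (∀ v, (∀ j, 0 ≤ v j) → |affineRatio θ α v ^ 2| ≤ B) ∧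
    ∀ v w, (∀ j, 0 ≤ v j) → (∀ j, 0 ≤ w j) →
      |affineRatio θ α v ^ 2 - affineRatio θ α w ^ 2| ≤ L * ∑ j, min 1 |v j - w j| := by
  obtain ⟨B, L, hL, hB, hBL⟩ := exists_affineRatio_bounds hα θ
  have hB0 : 0 ≤ B := (abs_nonneg _).trans (hB 0 fun _ => le_rfl)
  refine ⟨B ^ 2, 2 * B * L, by positivity, fun v hv => ?_, fun v w hv hw => ?_⟩
  · rw [abs_pow]
    exact pow_le_pow_left₀ (abs_nonneg _) (hB v hv) 2
  · rw [sq_sub_sq, abs_mul, mul_assoc]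
    refine mul_le_mul ?_ (hBL v w hv hw) (abs_nonneg _) (by positivity)
    exact (abs_add_le _ _).trans (by linarith [hB v hv, hB w hw])

end Ratio

/-! ### From the hypotheses to the contracting recursion and the covariance matrix -/

section Setting

variable {Ω : Type*} [MeasurableSpace Ω] {μ : Measure Ω} {p : ℕ}

theorem RegularCoeff.sum_lt_one {a : Fin (p + 1) → ℝ → ℝ} (ha : RegularCoeff a) {u : ℝ}
    (hu : u ∈ Set.Ioc (0 : ℝ) 1) : ∑ j : Fin p, a j.succ u < 1 := by
  obtain ⟨ρ, Q, M, ν, ℓ, hρ, hQ, hM, hν, hν1, hℓ, -, hle, hsum, -, hsummable⟩ := ha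
  have hpos : ∀ j : ℕ, 0 < ℓ (j + 1) := fun j => hℓ _ (by omega)
  -- Needed because a divergent `tsum` is `0` by default and would not bound the partial sum.
  have hs : Summable fun j : ℕ => 1 / ℓ (j + 1) := by
    refine hsummable.of_nonneg_of_le (fun j => (one_div_pos.2 (hpos j)).le) fun j => ?_
    have := hpos j
    gcongr
    simp
  calc ∑ j : Fin p, a j.succ u ≤ ∑ j : Fin p, Q * (1 / ℓ (j + 1)) :=
        Finset.sum_le_sum fun j _ => (hle j u hu).trans_eq (by ring)
    _ = Q * ∑ j ∈ Finset.range p, 1 / ℓ (j + 1) := by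
        rw [← Finset.mul_sum, Finset.sum_range]
    _ ≤ Q * ∑' j : ℕ, 1 / ℓ (j + 1) := by
        gcongr
        exact hs.sum_le_tsum _ fun j _ => (one_div_pos.2 (hpos j)).le
    _ < 1 := by linarith

theorem pos_of_mem_paramSpace {ρ₁ ρ₂ : ℝ} (hρ : 0 < ρ₁) {α : Param p}
    (h : α ∈ paramSpace p ρ₁ ρ₂) (i : Fin (p + 1)) : 0 < α i := by
  refine Fin.cases ?_ (fun j => ?_) i
  · exact hρ.trans_le h.2.1
  · exact hρ.trans_le (h.2.2.2 j)

theorem archForm_pos {α : Param p} (hα : ∀ i, 0 < α i) (x : ℤ → ℝ) (t : ℤ) :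
    0 < archForm x t α :=
  (hα 0).trans_le (le_affine (v := lags p (fun s => x s ^ 2) t) hα fun _ => sq_nonneg _)

/-- Squaring removes the root and makes the recursion linear. The measurable versions `Z'` generate
genuine sub-`σ`-algebras. -/
theorem isSquareARCH {α : Param p} (hα : ∀ i, 0 < α i) (hsum : ∑ j : Fin p, α j.succ < 1)
    {Z Z' Y : ℤ → Ω → ℝ} (hZ : IsInnovation Z μ) (hZ' : ∀ t, Measurable (Z' t))
    (hZZ' : ∀ t, Z t =ᵐ[μ] Z' t) (hY : IsStationaryARCH α Z Y μ) :
    IsSquareARCH (α 0) (fun j => α j.succ) (fun t ω => Z' t ω ^ 2) (fun t ω => Y t ω ^ 2) μ where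
  measurable t := (hZ' t).pow_const 2
  nonneg t ω := sq_nonneg _
  integrable t := ((hZ.memLp_two t).ae_eq (hZZ' t)).integrable_sq
  integral_eq_one t := by
    rw [← hZ.second_moment t]
    refine integral_congr_ae ?_
    filter_upwards [hZZ' t] with ω h using by rw [h]
  indep := (hZ.indep.congr hZZ').comp (fun _ x => x ^ 2) fun _ => by fun_prop
  aemeasurable t := (hY.aemeasurable t).pow_const 2
  nonneg' t ω := sq_nonneg _
  recurrence := by
    filter_upwards [ae_all_iff.2 hZZ', ae_all_iff.2 hY.repr] with ω h1 h2 t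
    rw [h2, mul_pow, Real.sq_sqrt (archForm_pos hα _ _).le, h1, mul_comm]
    rfl
  stationary h := (hY.stationary h).comp (u := fun (x : ℤ → ℝ) t => x t ^ 2) (by fun_prop)
  const_nonneg := (hα 0).le
  coeff_nonneg j := (hα _).le
  sum_lt_one := hsum

variable [IsProbabilityMeasure μ]

theorem integrable_archForm_div_mul {α : Param p} (hα : ∀ i, 0 < α i) {Y : ℤ → Ω → ℝ}
    (hY : ∀ t, AEMeasurable (Y t) μ) (θ θ' : Param p) (t : ℤ) :
    Integrable (fun ω => archForm (fun s => Y s ω) t θ / archForm (fun s => Y s ω) t α *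
      (archForm (fun s => Y s ω) t θ' / archForm (fun s => Y s ω) t α)) μ := by
  have h : ∀ θ : Param p, MemLp (fun ω => archForm (fun s => Y s ω) t θ /
      archForm (fun s => Y s ω) t α) 2 μ := fun θ => by
    obtain ⟨B, L, -, hB, -⟩ := exists_affineRatio_bounds hα θ
    refine MemLp.of_bound (AEMeasurable.aestronglyMeasurable ?_) B (ae_of_all _ fun ω =>
      hB (lags p (fun s => Y s ω ^ 2) t) fun _ => sq_nonneg _)
    exact (measurable_affineRatio θ α).comp_aemeasurable
      (aemeasurable_pi_lambda _ fun _ => (hY _).pow_const 2)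
  exact (h θ).integrable_mul (h θ')

/-- The identity yields positive semidefiniteness and matches the Gaussian exponent with the limit
variance of the tested score. -/
theorem dotProduct_sigmaMatrix_mulVec {α : Param p} (hα : ∀ i, 0 < α i) {Y : ℤ → Ω → ℝ}
    (hY : ∀ t, AEMeasurable (Y t) μ) (θ : Param p) :
    θ.ofLp ⬝ᵥ (sigmaMatrix Y α μ).mulVec θ.ofLp = 1 / 2 *
      ∫ ω, (archForm (fun s => Y s ω) 0 θ / archForm (fun s => Y s ω) 0 α) ^ 2 ∂μ := by
  set g : Fin (p + 1) → Ω → ℝ := fun i ω => archForm (fun s => Y s ω) 0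
    (EuclideanSpace.single i (1 : ℝ) : Param p) / archForm (fun s => Y s ω) 0 α with hg
  have hI : ∀ i j, Integrable (fun ω => g i ω * g j ω) μ := fun i j =>
    integrable_archForm_div_mul hα hY _ _ 0
  have hsum : ∀ ω, archForm (fun s => Y s ω) 0 θ / archForm (fun s => Y s ω) 0 α =
      ∑ i, θ i * g i ω := fun ω => by
    rw [← inner_archGrad, PiLp.inner_apply, Finset.sum_div]
    refine Finset.sum_congr rfl fun i _ => ?_
    simp only [hg]
    rw [← archGrad_apply]
    simp
    ring
  have hentry : ∀ i j, sigmaMatrix Y α μ i j = 1 / 2 * ∫ ω, g i ω * g j ω ∂μ := fun i j => by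
    simp only [sigmaMatrix, Matrix.of_apply, gradient_archForm, archGrad_apply, hg]
    congr 1
    refine integral_congr_ae (ae_of_all _ fun ω => ?_)
    simp only
    rw [div_mul_div_comm, sq]
  have hsq : ∀ ω, (archForm (fun s => Y s ω) 0 θ / archForm (fun s => Y s ω) 0 α) ^ 2 =
      ∑ i, ∑ j, θ i * θ j * (g i ω * g j ω) := fun ω => by
    rw [hsum, sq, Finset.sum_mul_sum]
    exact Finset.sum_congr rfl fun i _ => Finset.sum_congr rfl fun j _ => by ring
  simp_rw [hsq]
  rw [integral_finsetSum _ fun i _ => integrable_finsetSum _ fun j _ => (hI i j).const_mul _,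
    Finset.mul_sum]
  refine Finset.sum_congr rfl fun i _ => ?_
  rw [integral_finsetSum _ fun j _ => (hI i j).const_mul _, Matrix.mulVec, dotProduct,
    Finset.mul_sum, Finset.mul_sum]
  refine Finset.sum_congr rfl fun j _ => ?_
  rw [hentry, integral_const_mul]
  ring

theorem posSemidef_smul_sigmaMatrix {α : Param p} (hα : ∀ i, 0 < α i) {Y : ℤ → Ω → ℝ}
    (hY : ∀ t, AEMeasurable (Y t) μ) {r : ℝ} (hr : 0 ≤ r) :
    (r • sigmaMatrix Y α μ).PosSemidef := by
  refine Matrix.PosSemidef.smul ?_ hr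
  refine Matrix.PosSemidef.of_dotProduct_mulVec_nonneg ?_ fun v => ?_
  · ext i j
    simp only [sigmaMatrix, Matrix.conjTranspose_apply, Matrix.of_apply, star_trivial]
    simp_rw [mul_comm]
  · have := dotProduct_sigmaMatrix_mulVec hα hY (WithLp.toLp 2 v)
    simp only [star_trivial]
    rw [this]
    exact mul_nonneg (by norm_num) (integral_nonneg fun ω => sq_nonneg _)

end Setting

/-! ### The kernel window lies inside the sample -/

section Weights

variable {p : ℕ} {u₀ : ℝ} {t₀ : ℕ → ℕ} {b : ℕ → ℝ}

/-- The window has half-width `bN/2`, eventually at most `u₀ N / 2` and `(1 - u₀) N / 2`, and its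
center is within `1` of `u₀ N`. The remaining margins grow linearly in `N`. -/
theorem eventually_kernel_window (hu₀ : u₀ ∈ Set.Ioo (0 : ℝ) 1)
    (ht₀ : ∀ N : ℕ, 1 ≤ N → |u₀ - (t₀ N : ℝ) / (N : ℝ)| < 1 / (N : ℝ))
    (hb : Tendsto b atTop (𝓝 0)) (hbN : Tendsto (fun N : ℕ => b N * (N : ℝ)) atTop atTop) (q : ℕ) :
    ∀ᶠ N : ℕ in atTop, ∀ j : ℤ, |1 / (b N * N) * j| ≤ 1 / 2 →
      (q : ℤ) ≤ t₀ N - j ∧ (t₀ N : ℤ) - j ≤ N := by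
  have hN1 : Tendsto (fun N : ℕ => (N : ℝ) * (u₀ / 2)) atTop atTop :=
    tendsto_natCast_atTop_atTop.atTop_mul_const (half_pos hu₀.1)
  have hN2 : Tendsto (fun N : ℕ => (N : ℝ) * ((1 - u₀) / 2)) atTop atTop :=
    tendsto_natCast_atTop_atTop.atTop_mul_const (half_pos (sub_pos.2 hu₀.2))
  filter_upwards [hb.eventually_le_const hu₀.1, hb.eventually_le_const (sub_pos.2 hu₀.2),
    hbN.eventually_gt_atTop 0, eventually_ge_atTop 1, hN1.eventually_ge_atTop (q + 1),
    hN2.eventually_ge_atTop 1] with N h1 h2 h3 h4 h5 h6 j hj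
  have hN : (0 : ℝ) < N := by exact_mod_cast h4
  have ht := ht₀ N h4
  have hj' : |(j : ℝ)| ≤ b N * N / 2 := by
    rw [abs_mul, abs_of_pos (one_div_pos.2 h3), one_div_mul_eq_div, div_le_iff₀ h3] at hj
    linarith
  have ht' : |u₀ * N - t₀ N| < 1 := by
    have : u₀ * N - t₀ N = (u₀ - t₀ N / N) * N := by field_simp
    rw [this, abs_mul, abs_of_pos hN]
    calc _ < 1 / (N : ℝ) * N := by gcongr
      _ = 1 := by field_simp
  have hj1 := abs_le.1 hj'
  have ht1 := abs_lt.1 ht'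
  have hbu : b N * N ≤ u₀ * N := by gcongr
  have hbu' : b N * N ≤ (1 - u₀) * N := by gcongr
  constructor
  · have : (q : ℝ) ≤ t₀ N - j := by linarith
    exact_mod_cast this
  · have : (t₀ N : ℝ) - j ≤ N := by linarith
    exact_mod_cast this

end Weights

/-! ### Convergence of the characteristic functions of the score -/

section Score

variable {Ω : Type*} {mΩ : MeasurableSpace Ω} {μ : Measure Ω} [IsProbabilityMeasure μ] {p : ℕ}

/-- The limit of the characteristic functions of kernel-weighted sums of `Ψ · (1 - X) / 2`, for a
predictable quotient `Ψ` of affine forms of the lagged squares. -/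
theorem tendsto_integral_cexp_kernel_sum {α θ : Param p} (hα : ∀ i, 0 < α i) {X V : ℤ → Ω → ℝ}
    (h : IsSquareARCH (α 0) (fun j => α j.succ) X V μ)
    (hid : ∀ t, IdentDistrib (X t) (X 0) μ μ) (hX2 : MemLp (X 0) 2 μ)
    {W : ℝ → ℝ} (hW : IsKernel W) {e : ℕ → ℝ} (he0 : ∀ᶠ N in atTop, 0 < e N)
    (he : Tendsto e atTop (𝓝 0)) {t₀ : ℕ → ℕ}
    (hrange : ∀ᶠ N in atTop, ∀ j : ℤ, |e N * j| ≤ 1 / 2 →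
      ((p + 1 : ℕ) : ℤ) ≤ t₀ N - j ∧ (t₀ N : ℤ) - j ≤ N) :
    Tendsto (fun N => ∫ ω, Complex.exp ((∑ k ∈ Finset.Icc (p + 1) N,
      √(e N) * W (e N * (t₀ N - k)) * affineRatio θ α (lags p (fun r => V r ω) k) *
        ((1 - X k ω) / 2) : ℝ) * Complex.I) ∂μ) atTop
      (𝓝 (Real.exp (-((∫ ω, ((1 - X 0 ω) / 2) ^ 2 ∂μ) / 2 *
        ((∫ x in (-1 / 2 : ℝ)..(1 / 2), W x ^ 2) *
          ∫ ω, affineRatio θ α (lags p (fun r => V r ω) 0) ^ 2 ∂μ))) : ℝ)) := by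
  obtain ⟨K, hK⟩ := hW.exists_bound
  set w₂ := ∫ x in (-1 / 2 : ℝ)..(1 / 2), W x ^ 2 with hw₂
  set γ := ∫ ω, affineRatio θ α (lags p (fun r => V r ω) 0) ^ 2 ∂μ with hγ
  have hK0 : 0 ≤ K := (abs_nonneg _).trans (hK 0)
  have hw₂0 : 0 ≤ w₂ := intervalIntegral.integral_nonneg (by norm_num) fun x _ => sq_nonneg _
  have hγ0 : 0 ≤ γ := integral_nonneg fun ω => sq_nonneg _
  obtain ⟨B, L, hL, hB, hBL⟩ := exists_affineRatio_bounds hα θ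
  obtain ⟨B', L', hL', hB', hBL'⟩ := exists_sq_affineRatio_bounds hα θ
  have hΨ := measurable_affineRatio θ α
  have hΨ2 : Measurable fun v => affineRatio θ α v ^ 2 := hΨ.pow_const 2
  -- Zero weights for `k ≤ p` let the sums start at `0`, as the limit theorems require.
  set c : ℕ → ℕ → ℝ := fun N k => if p + 1 ≤ k then √(e N) * W (e N * (t₀ N - k)) else 0 with hc
  have hWK : ∀ N x, |√(e N) * W x| ≤ √(e N) * K := fun N x => by
    rw [abs_mul, abs_of_nonneg (Real.sqrt_nonneg _)]
    exact mul_le_mul_of_nonneg_left (hK x) (Real.sqrt_nonneg _)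
  have hcK : ∀ N k, |c N k| ≤ √(e N) * K := fun N k => by
    simp only [hc]
    split_ifs
    · exact hWK _ _
    · rw [abs_zero]; positivity
  have hsum : ∀ (N : ℕ) (f : ℕ → ℝ → ℝ), (∀ k, f k 0 = 0) → ∑ k ∈ Finset.range (N + 1),
      f k (c N k) = ∑ k ∈ Finset.Icc (p + 1) N, f k (√(e N) * W (e N * (t₀ N - k))) := by
    intro N f hf
    have h1 : ∀ k, f k (c N k) = if p + 1 ≤ k then f k (√(e N) * W (e N * (t₀ N - k))) else 0 :=
      fun k => by
        simp only [hc]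
        split_ifs
        · rfl
        · exact hf k
    simp_rw [h1]
    rw [← Finset.sum_filter]
    refine Finset.sum_congr ?_ fun _ _ => rfl
    ext k
    simp only [Finset.mem_filter, Finset.mem_range, Finset.mem_Icc]
    omega
  have hsqrt : Tendsto (fun N => √(e N)) atTop (𝓝 0) := by
    simpa [Function.comp_def] using (Real.continuous_sqrt.tendsto 0).comp he
  have hm1 : Tendsto (fun N => √(e N) * K) atTop (𝓝 0) := by simpa using hsqrt.mul_const K
  have hm2 : Tendsto (fun N => (√(e N) * K) ^ 2) atTop (𝓝 0) := by simpa using hm1.pow 2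
  have hriem : Tendsto (fun N => ∑ k ∈ Finset.range (N + 1), c N k ^ 2) atTop (𝓝 w₂) := by
    have h1 := tendsto_riemannSum (f := fun x => W x ^ 2) (K := K ^ 2) (fun x => by
      rw [abs_pow]; exact pow_le_pow_left₀ (abs_nonneg _) (hK x) 2)
      (fun x hx => by rw [hW.support x hx]; norm_num)
      (by filter_upwards [hW.ae_continuousAt] with x hx using hx.pow 2) he0 he hrange
    refine h1.congr' ?_
    filter_upwards [he0] with N hN
    rw [hsum N (fun _ y => y ^ 2) fun _ => by norm_num]
    refine Finset.sum_congr rfl fun k _ => ?_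
    rw [mul_pow, Real.sq_sqrt hN.le]
  have hC : ∀ᶠ N in atTop, ∑ k ∈ Finset.range (N + 1), c N k ^ 2 ≤ w₂ + 1 :=
    hriem.eventually_le_const (by linarith)
  choose G hGm hGeq v hGv hv using fun k : ℕ => h.exists_causal_comp hΨ (k : ℤ)
  have hmeas2 : ∀ k : ℕ, AEMeasurable
      (fun ω => affineRatio θ α (lags p (fun r => V r ω) k) ^ 2) μ := fun k =>
    h.aemeasurable_comp_lags hΨ2 _
  have hlln0 : Tendsto (fun N => ∫ ω, |∑ k ∈ Finset.range (N + 1), c N k ^ 2 *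
      (affineRatio θ α (lags p (fun r => V r ω) k) ^ 2 - γ)| ∂μ) atTop (𝓝 0) := by
    refine tendsto_integral_abs_weighted_sum (B := B' + |γ|) (fun k => (hmeas2 k).sub_const γ)
      (fun k ω => (abs_sub _ _).trans (add_le_add_left
        (hB' (lags p (fun r => V r ω) k) fun _ => h.nonneg' _ _) _)) (fun δ hδ => ?_)
      (Eventually.of_forall fun N k => sq_nonneg _) (m := fun N => (√(e N) * K) ^ 2)
      (Eventually.of_forall fun N k => ?_) hm2 hC
    · obtain ⟨M, hM⟩ := h.exists_abs_covariance_le hΨ2 hB' hL' hBL' hγ.symm hδ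
      exact ⟨M, fun k l hkl => hM k l (by exact_mod_cast hkl)⟩
    · rw [← sq_abs]
      exact pow_le_pow_left₀ (abs_nonneg _) (hcK N k) 2
  -- The error splits into `∑ c_k² (Ψ_k² - γ)`, handled by the weak law, and `(∑ c_k² - w₂) γ`,
  -- handled by the Riemann sum.
  have hlln : Tendsto (fun N => ∫ ω, |∑ k ∈ Finset.range (N + 1), c N k ^ 2 * G k ω ^ 2 -
      w₂ * γ| ∂μ) atTop (𝓝 0) := by
    have h1 : Tendsto (fun N => |∑ k ∈ Finset.range (N + 1), c N k ^ 2 - w₂| * γ) atTop (𝓝 0) := by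
      have := ((hriem.sub_const w₂).abs).mul_const γ
      simpa using this
    refine squeeze_zero (fun N => integral_nonneg fun ω => abs_nonneg _) (fun N => ?_)
      (by simpa using hlln0.add h1)
    have hI : Integrable (fun ω => |∑ k ∈ Finset.range (N + 1), c N k ^ 2 *
        (affineRatio θ α (lags p (fun r => V r ω) k) ^ 2 - γ)|) μ := by
      refine Integrable.abs (integrable_finsetSum _ fun k _ => Integrable.const_mul
        (Integrable.sub (Integrable.of_bound (hmeas2 k).aestronglyMeasurable B'
          (ae_of_all _ fun ω => ?_)) (integrable_const γ)) _)
      exact hB' (lags p (fun r => V r ω) k) fun _ => h.nonneg' _ _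
    calc _ ≤ ∫ ω, (|∑ k ∈ Finset.range (N + 1), c N k ^ 2 *
          (affineRatio θ α (lags p (fun r => V r ω) k) ^ 2 - γ)| +
          |∑ k ∈ Finset.range (N + 1), c N k ^ 2 - w₂| * γ) ∂μ := by
          refine integral_mono_of_nonneg (ae_of_all _ fun ω => abs_nonneg _)
            (hI.add (integrable_const _)) ?_
          filter_upwards [ae_all_iff.2 hGeq] with ω hω
          have h2 : ∑ k ∈ Finset.range (N + 1), c N k ^ 2 * G k ω ^ 2 - w₂ * γ =
              ∑ k ∈ Finset.range (N + 1), c N k ^ 2 *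
                (affineRatio θ α (lags p (fun r => V r ω) k) ^ 2 - γ) +
              (∑ k ∈ Finset.range (N + 1), c N k ^ 2 - w₂) * γ := by
            simp only [mul_sub, Finset.sum_sub_distrib, hω, ← Finset.sum_mul]
            ring
          rw [h2]
          refine (abs_add_le _ _).trans_eq ?_
          rw [abs_mul _ γ, abs_of_nonneg hγ0]
      _ = _ := by
          rw [integral_add hI (integrable_const _)]
          simp
  have hξid : ∀ k : ℕ, IdentDistrib (fun ω => (1 - X k ω) / 2)
      (fun ω => (1 - X (0 : ℕ) ω) / 2) μ μ :=
    fun k => (hid k).comp (u := fun x => (1 - x) / 2) (by fun_prop)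
  have key := tendsto_integral_cexp_sum (μ := μ) (F := fun k : ℕ => sigmaOf X (Set.Iio (k : ℤ)))
    (ξ := fun k ω => (1 - X k ω) / 2) (η := G) (B := B) (n := fun N => N + 1) (c := c)
    (m := fun N => √(e N) * K) (C := w₂ + 1) (v := w₂ * γ)
    (fun k => sigmaOf_le h.measurable)
    (fun k l hkl => sigmaOf_mono (Set.Iio_subset_Iio (by exact_mod_cast hkl)))
    (fun k => ((measurable_sigmaOf (X := X) (t := (k : ℤ)) (by simp)).const_sub 1).div_const 2)
    hGm (fun k => ?_) hξid ?_ ?_ (fun k ω => ?_)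
    (Eventually.of_forall hcK) hm1 hC (by positivity) hlln
  · refine key.congr fun N => ?_
    refine integral_congr_ae ?_
    filter_upwards [ae_all_iff.2 hGeq] with ω hω
    rw [hsum N (fun k y => y * G k ω * ((1 - X k ω) / 2)) fun _ => by ring]
    simp only [← hω]
  · have h1 := indep_iSup_of_disjoint (fun i => (h.measurable i).comap_le) h.indep
      (S := Set.Iio (k : ℤ)) (T := {(k : ℤ)}) (by simp)
    refine indep_of_indep_of_le_right h1 ?_
    exact (((measurable_sigmaOf (X := X) (t := (k : ℤ)) (Set.mem_singleton _)).const_sub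
      1).div_const 2).comap_le
  · have := ((memLp_const (1 : ℝ)).sub hX2).mul_const (2 : ℝ)⁻¹
    simpa [div_eq_mul_inv] using this
  · have h1 := h.integral_eq_one 0
    simp only [Nat.cast_zero]
    rw [integral_div, integral_sub (integrable_const _) (h.integrable 0), h1]
    simp
  · rw [hGv]
    exact hB _ (hv k ω)

end Score

/-- With `x_k² = w_k z_k²`, the derivative `1/w_k - x_k²/w_k²` collapses to `(1 - z_k²)/w_k`. The
normalizations combine to `√(bN) / (bN) = √(1/(bN))`. -/
theorem inner_scaled_gradient {p : ℕ} {α θ : Param p} (hα : ∀ i, 0 < α i) {W : ℝ → ℝ} {b : ℝ}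
    {N t₀ : ℕ} (hb : 0 < b * N) {x z : ℤ → ℝ}
    (hx : ∀ t, x t = √(archForm x t α) * z t) :
    inner ℝ (√(b * N) • gradient (weightedLik W b N t₀ x) α) θ =
      ∑ k ∈ Finset.Icc (p + 1) N, √(1 / (b * N)) * W (1 / (b * N) * (t₀ - k)) *
        affineRatio θ α (lags p (fun r => x r ^ 2) k) * ((1 - z k ^ 2) / 2) := by
  rw [gradient_weightedLik fun t => (archForm_pos hα x t).ne', real_inner_smul_left, sum_inner,
    Finset.mul_sum]
  refine Finset.sum_congr rfl fun k _ => ?_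
  have hw := archForm_pos hα x k
  have hsq : x k ^ 2 = archForm x k α * z k ^ 2 := by
    rw [hx, mul_pow, Real.sq_sqrt hw.le]
  have hs : √(b * N) * (1 / (b * N)) = √(1 / (b * N)) := by
    have h1 := Real.sqrt_pos.2 hb
    rw [Real.sqrt_div zero_le_one, Real.sqrt_one]
    nth_rewrite 2 [← Real.mul_self_sqrt hb.le]
    field_simp
  rw [real_inner_smul_left, inner_archGrad, affineRatio_lags, hsq, ← hs, one_div_mul_eq_div]
  field_simp

end TvARCH

/-! ### The asymptotic normality of the score -/

theorem proposition2 {Ω : Type*} [MeasurableSpace Ω] (μ : Measure Ω) [IsProbabilityMeasure μ]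
    (p : ℕ)
    -- the innovations, the parameter functions and the tvARCH(p) process
    (Z : ℤ → Ω → ℝ) (hZ : TvARCH.IsInnovation Z μ)
    (a : Fin (p + 1) → ℝ → ℝ)
    (X : ℕ → ℤ → Ω → ℝ) (_hX : TvARCH.IsTvARCH a Z X μ)
    -- (i) bounds and regularity of the parameter functions
    (ha : TvARCH.RegularCoeff a)
    -- (ii) moments of the innovations
    (hmom : ∃ δ : ℝ, 0 < δ ∧ ∀ t, Integrable (fun ω => |Z t ω| ^ (4 * (1 + δ))) μ)
    -- (iii) the parameters are interior points of the parameter space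
    (hint : ∃ ρ₁ ρ₂ : ℝ, 0 < ρ₁ ∧ ρ₁ ≤ ρ₂ ∧
      ∀ u ∈ Set.Ioc (0 : ℝ) 1, TvARCH.coeff a u ∈ interior (TvARCH.paramSpace p ρ₁ ρ₂))
    -- the kernel, the point `u₀`, the stationary approximation at `u₀`
    (W : ℝ → ℝ) (hW : TvARCH.IsKernel W)
    (u₀ : ℝ) (hu₀ : u₀ ∈ Set.Ioo (0 : ℝ) 1)
    (Y : ℤ → Ω → ℝ) (hY : TvARCH.IsStationaryARCH (TvARCH.coeff a u₀) Z Y μ)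
    -- the centers `t₀ = t₀(N)` and the bandwidths `b = b(N)`
    (t₀ : ℕ → ℕ) (ht₀ : ∀ N : ℕ, 1 ≤ N → |u₀ - (t₀ N : ℝ) / (N : ℝ)| < 1 / (N : ℝ))
    (b : ℕ → ℝ) (hb : Tendsto b atTop (𝓝 0))
    (hbN : Tendsto (fun N : ℕ => b N * (N : ℝ)) atTop atTop) :
    TendstoInDistribution
      (fun (N : ℕ) (ω : Ω) => √(b N * (N : ℝ)) •
        gradient (TvARCH.weightedLik W (b N) N (t₀ N) (fun s => Y s ω)) (TvARCH.coeff a u₀))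
      atTop
      (id : TvARCH.Param p → TvARCH.Param p)
      (fun _ => μ)
      (multivariateGaussian 0
        (((∫ x in (-1 / 2 : ℝ)..(1 / 2), W x ^ 2) * (variance (fun ω => Z 0 ω ^ 2) μ / 2)) •
          TvARCH.sigmaMatrix Y (TvARCH.coeff a u₀) μ)) := by
  open TvARCH in
  have hu : u₀ ∈ Set.Ioc (0 : ℝ) 1 := Set.Ioo_subset_Ioc_self hu₀
  have hsum : ∑ j : Fin p, (coeff a u₀) j.succ < 1 := ha.sum_lt_one hu
  set α := coeff a u₀ with hαdef
  have hα : ∀ i, 0 < α i := by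
    obtain ⟨ρ₁, ρ₂, hρ, -, hmem⟩ := hint
    exact pos_of_mem_paramSpace hρ (interior_subset (hmem u₀ hu))
  have hw₂ : 0 ≤ ∫ x in (-1 / 2 : ℝ)..(1 / 2), W x ^ 2 :=
    intervalIntegral.integral_nonneg (by norm_num) fun x _ => sq_nonneg _
  have hvar := variance_nonneg (fun ω => Z 0 ω ^ 2) μ
  have hYm := hY.aemeasurable
  have hform : ∀ t (θ : Param p), AEMeasurable (fun ω => archForm (fun s => Y s ω) t θ) μ :=
    fun t θ => by
      unfold archForm
      fun_prop
  have hmeas : ∀ N : ℕ, AEMeasurable (fun ω => √(b N * (N : ℝ)) •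
      gradient (weightedLik W (b N) N (t₀ N) (fun s => Y s ω)) α) μ := fun N => by
    simp_rw [fun ω => gradient_weightedLik (W := W) (b := b N) (N := N) (t₀ := t₀ N)
      fun t => (archForm_pos hα (fun s => Y s ω) t).ne']
    refine (?_ : AEMeasurable _ μ).const_smul (√(b N * (N : ℝ)))
    refine Finset.aemeasurable_fun_sum _ fun k _ => ?_
    refine AEMeasurable.smul ((((hform _ _).inv.sub (((hYm _).pow_const 2).div
      ((hform _ _).pow_const 2))).const_mul _).const_mul _) ?_
    refine (WithLp.measurable_toLp 2 _).comp_aemeasurable (aemeasurable_pi_lambda _ fun i => ?_)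
    refine Fin.cases ?_ (fun j => ?_) i
    · simp
    · simpa using (hYm _).pow_const 2
  refine ⟨hmeas, aemeasurable_id, ?_⟩
  refine ProbabilityMeasure.tendsto_iff_tendsto_charFun.2 fun θ => ?_
  let Z' : ℤ → Ω → ℝ := fun t => (hZ.aemeasurable t).mk (Z t)
  have hZ' : ∀ t, Measurable (Z' t) := fun t => (hZ.aemeasurable t).measurable_mk
  have hZZ' : ∀ t, Z t =ᵐ[μ] Z' t := fun t => (hZ.aemeasurable t).ae_eq_mk
  have hARCH := isSquareARCH hα hsum hZ hZ' hZZ' hY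
  have hZ4 : MemLp (fun ω => Z' 0 ω ^ 2) 2 μ := by
    obtain ⟨δ, hδ, hI⟩ := hmom
    rw [memLp_two_iff_integrable_sq ((hZ' 0).pow_const 2).aestronglyMeasurable]
    refine Integrable.mono' ((integrable_const (1 : ℝ)).add (hI 0))
      (((hZ' 0).pow_const 2).pow_const 2).aestronglyMeasurable ?_
    filter_upwards [hZZ' 0] with ω hω
    rw [← hω, Real.norm_of_nonneg (by positivity), Pi.add_apply]
    have h1 : (Z 0 ω ^ 2) ^ 2 = |Z 0 ω| ^ (4 : ℝ) := by
      rw [← sq_abs (Z 0 ω), ← pow_mul]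
      exact_mod_cast (Real.rpow_natCast |Z 0 ω| 4).symm
    rw [h1]
    have h2 : 0 ≤ |Z 0 ω| ^ (4 * (1 + δ)) := by positivity
    rcases le_total |Z 0 ω| 1 with h3 | h3
    · have := Real.rpow_le_one (abs_nonneg (Z 0 ω)) h3 (by norm_num : (0 : ℝ) ≤ 4)
      linarith
    · have := Real.rpow_le_rpow_of_exponent_le h3 (by linarith : (4 : ℝ) ≤ 4 * (1 + δ))
      linarith
  have hid : ∀ t, IdentDistrib (fun ω => Z' t ω ^ 2) (fun ω => Z' 0 ω ^ 2) μ μ := fun t =>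
    (((IdentDistrib.of_ae_eq (hZ' t).aemeasurable (hZZ' t).symm).trans (hZ.identDistrib t)).trans
      (IdentDistrib.of_ae_eq (hZ.aemeasurable 0) (hZZ' 0))).comp (u := fun x => x ^ 2) (by fun_prop)
  -- The constants agree: `var/4` here is the `var/2` of the statement times the `½` inside `Σ`.
  have hs : ∫ ω, ((1 - Z' 0 ω ^ 2) / 2) ^ 2 ∂μ = variance (fun ω => Z 0 ω ^ 2) μ / 4 := by
    rw [variance_eq_integral ((hZ.aemeasurable 0).pow_const 2), hZ.second_moment 0, ← integral_div]
    refine integral_congr_ae ?_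
    filter_upwards [hZZ' 0] with ω hω
    rw [hω]
    ring
  have he0 : ∀ᶠ N : ℕ in atTop, 0 < 1 / (b N * N) := by
    filter_upwards [hbN.eventually_gt_atTop 0] with N hN using one_div_pos.2 hN
  have he : Tendsto (fun N : ℕ => 1 / (b N * N)) atTop (𝓝 0) := by
    simp only [one_div]
    exact hbN.inv_tendsto_atTop
  have key := tendsto_integral_cexp_kernel_sum (θ := θ) hα hARCH hid hZ4 hW he0 he
    (eventually_kernel_window hu₀ ht₀ hb hbN (p + 1))
  have hlimit : charFun ((multivariateGaussian 0
      (((∫ x in (-1 / 2 : ℝ)..(1 / 2), W x ^ 2) * (variance (fun ω => Z 0 ω ^ 2) μ / 2)) •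
        sigmaMatrix Y α μ)).map id) θ = ((Real.exp (-((∫ ω, ((1 - Z' 0 ω ^ 2) / 2) ^ 2 ∂μ) / 2 *
        ((∫ x in (-1 / 2 : ℝ)..(1 / 2), W x ^ 2) *
          ∫ ω, affineRatio θ α (lags p (fun r => Y r ω ^ 2) 0) ^ 2 ∂μ))) : ℝ) : ℂ) := by
    rw [Measure.map_id, charFun_multivariateGaussian
      (posSemidef_smul_sigmaMatrix hα hYm (by positivity)), inner_zero_right, Matrix.smul_mulVec,
      dotProduct_smul, dotProduct_sigmaMatrix_mulVec hα hYm, hs]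
    simp only [affineRatio_lags]
    rw [Complex.ofReal_exp]
    congr 1
    push_cast
    simp only [smul_eq_mul]
    push_cast
    ring
  simp only [ProbabilityMeasure.coe_mk]
  rw [hlimit]
  refine key.congr' ?_
  filter_upwards [hbN.eventually_gt_atTop 0] with N hN
  rw [charFun_apply, integral_map (hmeas N) (by fun_prop)]
  refine integral_congr_ae ?_
  filter_upwards [ae_all_iff.2 hZZ', ae_all_iff.2 hY.repr] with ω h1 h2
  rw [inner_scaled_gradient hα hN h2]
  simp only [h1]
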